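/- All graphs are finite and simple. For a graph $G$, a set $M\subseteq V(G)$ is a *module* if every vertex outside $M$ is adjacent to all or to none of the vertices of $M$; a *splitter* of $M$ is a vertex outside $M$ with both a neighbour and a non-neighbour in $M$. $G$ is *prime* if each of its modules has at most one element or equals $V(G)$. A module is *strong* if it overlaps no other module (any other module contains it, is contained in it, or is disjoint from it). The nodes of the *modular decomposition* of $G$ are the nonempty strong modules (each node being identified with the set of leaves of the subtree rooted at it), the children of a node are the maximal nonempty strong modules properly contained in it, and an internal node is *prime* if its quotient graph (the graph induced by one vertex from each child) is a prime graph that is neither complete nor edgeless. A *realiser* of $G$ is a pair $(\sigma,\tau)$ of linear orderings of $V(G)$ such that $uv$ is an edge exactly when $\sigma$ and $\tau$ order $u,v$ differently; $G$ is a *permutation graph* if it has a realiser. An *interval* of an ordering is a set of consecutive elements of it. A vertex is *extremal* if it is first or last in $\sigma$ or in $\tau$. A *trigraph* has disjoint sets of black and red edges. *Contracting* two vertices $u,v$ replaces them by a new vertex $x$ which has a black edge to the common black neighbours of $u$ and $v$, no edge to the vertices adjacent to neither of them, and a red edge to all other remaining vertices. A *$d$-sequence* of an $n$-vertex graph $G$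 is a sequence of trigraphs $G_n=G,\dots,G_1$, each obtained from the previous one by contracting two vertices, where $G_1$ has one vertex and all red degrees are at most $d$; the *twin-width* of $G$ is the least $d$ for which a $d$-sequence exists. A vertex $v$ of $G$ *is incident to a red edge in $G_t$* if the vertex of $G_t$ into which $v$ has been contracted is. We say that $s$ is the *last* vertex to become incident to a red edge if $s$ does become incident to a red edge and, in the first trigraph of the sequence in which this happens, all vertices are or have already been incident to a red edge. **Statement.** Let $G$ be a prime permutation graph of twin-width $1$, let $(\sigma,\tau)$ be a realiser of $G$, and let $s$ be an extremal vertex, say first or last in $\sigma$, such that $G$ has a $1$-sequence in which $s$ is the last vertex to become incident to a red edge. Let $G^1=G[N(s)]$ and $G^2=G[\overline N(s)]$, where $\overline N(s)=V(G)\setminus(N(s)\cup\{s\})$. Then there are $i\in\{1,2\}$ and a module $M$ of $G^i$ such that $M$ has a unique splitter $s'$ in $G$, $s'\in V(G^{3-i})$, the graph $G[M\cup\{s'\}]$ has a $1$-sequence in which $s'$ is the last vertex to become incident to a red edge, and one of the following holds: (i) $M$ is a pair of twins of $G^i$ that are consecutive in the restriction of $\sigma$ or of $\tau$ to $V(G^i)$,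 and there are no prime nodes in the modular decompositions of $G^1$ and $G^2$; or (ii) $M$ is the set of leaves of the subtree rooted at a prime node $p$ of the modular decomposition of $G^i$, and $p$ is the unique prime node in the modular decompositions of $G^1$ and $G^2$. Moreover, with $k=|V(G)\setminus(M\cup\{s'\})|$, there is a bijection $\pi:\{1,\dots,k\}\to V(G)\setminus(M\cup\{s'\})$ such that for every $j\in\{1,\dots,k\}$ the set $M\cup\{s'\}\cup\{\pi(1),\dots,\pi(j)\}$ is an interval of $\sigma$ and is the union of two disjoint nonempty intervals of $\tau$. -/

import Mathlib

namespace TwinWidthOne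

/-! ### Modules and prime graphs -/

section Modules

variable {V : Type*}

/-- `M` is a module of `G`: every vertex outside `M` is adjacent to all of `M` or to none of `M`. -/
def IsModule (G : SimpleGraph V) (M : Set V) : Prop :=
  ∀ v, v ∉ M → (∀ a ∈ M, G.Adj v a) ∨ (∀ a ∈ M, ¬ G.Adj v a)

/-- `v` is a splitter of `M`: it lies outside `M` and has a neighbour and a non-neighbour in `M`. -/
def IsSplitter (G : SimpleGraph V) (M : Set V) (v : V) : Prop :=
  v ∉ M ∧ (∃ a ∈ M, G.Adj v a) ∧ (∃ b ∈ M, ¬ G.Adj v b)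

/-- `G` is prime: every module has at most one element or is the whole vertex set. -/
def IsPrimeGraph (G : SimpleGraph V) : Prop :=
  ∀ M : Set V, IsModule G M → M.Subsingleton ∨ M = Set.univ

/-- Distinct vertices with the same neighbours apart from themselves. -/
def AreTwins (G : SimpleGraph V) (v w : V) : Prop :=
  v ≠ w ∧ G.neighborSet v \ {w} = G.neighborSet w \ {v}

/-- A strong module: a module that overlaps no other module. -/
def IsStrongModule (G : SimpleGraph V) (M : Set V) : Prop :=
  IsModule G M ∧ ∀ M' : Set V, IsModule G M' → M ⊆ M' ∨ M' ⊆ M ∨ Disjoint M M'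

/-- The nodes of the modular decomposition of `G`, each one given by the set of leaves of the
subtree rooted at it: these sets are the nonempty strong modules. -/
def IsNode (G : SimpleGraph V) (M : Set V) : Prop :=
  M.Nonempty ∧ IsStrongModule G M

/-- The children of the node `M`: the maximal nonempty strong modules properly contained in `M`. -/
def childNodes (G : SimpleGraph V) (M : Set V) : Set (Set V) :=
  {N | Maximal (fun K : Set V => IsNode G K ∧ K ⊂ M) N}

/-- The quotient graph of the node `M`: its vertices are the children of `M`, and two children
are adjacent when there is an edge (equivalently, all edges) between them. -/
def quotientGraph (G : SimpleGraph V) (M : Set V) : SimpleGraph (childNodes G M) :=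
  SimpleGraph.fromRel fun A B => ∃ a ∈ (A : Set V), ∃ b ∈ (B : Set V), G.Adj a b

/-- A prime node of the modular decomposition of `G`: an internal node whose quotient graph is a
prime graph and which is neither series (complete quotient) nor parallel (edgeless quotient). -/
def IsPrimeNode (G : SimpleGraph V) (M : Set V) : Prop :=
  IsNode G M ∧ M.Nontrivial ∧ IsPrimeGraph (quotientGraph G M) ∧
    quotientGraph G M ≠ ⊤ ∧ quotientGraph G M ≠ ⊥

end Modules

/-! ### Permutation graphs -/

section Permutation

variable {V : Type*} {n : ℕ}

/-- `(σ, τ)` is a realiser of `G`: the edges are the pairs ordered differently by `σ` and `τ`. -/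
def IsRealiser (G : SimpleGraph V) (σ τ : V ≃ Fin n) : Prop :=
  ∀ u v, G.Adj u v ↔ (σ u < σ v ∧ τ v < τ u) ∨ (σ v < σ u ∧ τ u < τ v)

/-- `s` is the first or the last vertex of the ordering `σ`. -/
def IsEndpoint (σ : V ≃ Fin n) (s : V) : Prop :=
  (∀ v, σ s ≤ σ v) ∨ (∀ v, σ v ≤ σ s)

/-- `I` is a set of consecutive elements for the ordering that `σ` induces on `U`. -/
def IsIntervalOn (σ : V ≃ Fin n) (U I : Set V) : Prop :=
  I ⊆ U ∧ ∀ u ∈ I, ∀ v ∈ I, ∀ w ∈ U, σ u ≤ σ w → σ w ≤ σ v → w ∈ I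

/-- `I` is an interval of the ordering `σ` of the whole vertex set. -/
def IsInterval (σ : V ≃ Fin n) (I : Set V) : Prop :=
  IsIntervalOn σ Set.univ I

/-- `S` is an interval of `σ` and is formed by two (disjoint, nonempty) intervals of `τ`. -/
def IsIntervalAndTwoIntervals (σ τ : V ≃ Fin n) (S : Set V) : Prop :=
  IsInterval σ S ∧ ∃ I J : Set V, I.Nonempty ∧ J.Nonempty ∧ Disjoint I J ∧ I ∪ J = S ∧
    IsInterval τ I ∧ IsInterval τ J

end Permutation

/-! ### Trigraphs, contraction sequences and twin-width -/

/-- A trigraph with vertices in `α`: disjoint sets of black and red edges on a vertex set. -/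
structure Trigraph (α : Type*) where
  verts : Set α
  black : SimpleGraph α
  red : SimpleGraph α
  disjoint : Disjoint black red
  black_mem : ∀ a b, black.Adj a b → a ∈ verts
  red_mem : ∀ a b, red.Adj a b → a ∈ verts

section Sequences

variable {V : Type*}

/-- The red degree of a vertex of a trigraph. -/
noncomputable def Trigraph.redDegree {α : Type*} (H : Trigraph α) (x : α) : ℕ :=
  (H.red.neighborSet x).ncard

/-- A graph seen as a trigraph without red edges. Vertices of the trigraphs of a contraction
sequence are labelled by the sets of original vertices contracted into them, so that the original
vertex `v` is `{v}`. -/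
def Trigraph.ofGraph (G : SimpleGraph V) : Trigraph (Set V) where
  verts := Set.range fun v : V => ({v} : Set V)
  black := SimpleGraph.fromRel fun P Q => ∃ u v, P = {u} ∧ Q = {v} ∧ G.Adj u v
  red := ⊥
  disjoint := disjoint_bot_right
  black_mem := by
    intro a b h
    rw [SimpleGraph.fromRel_adj] at h
    rcases h with ⟨-, ⟨u, v, rfl, -, -⟩ | ⟨u, v, -, rfl, -⟩⟩
    · exact ⟨u, rfl⟩
    · exact ⟨v, rfl⟩
  red_mem := by
    intro a b h
    exact h.elim

/-- The vertices that are neither contracted nor created when `X` and `Y` are contracted into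
`X ∪ Y`. (The label `X ∪ Y` is new for disjoint nonempty labels.) -/
def Trigraph.rest (H : Trigraph (Set V)) (X Y : Set V) : Set (Set V) :=
  H.verts \ {X, Y, X ∪ Y}

/-- The trigraph obtained by contracting `X` and `Y` into the new vertex `X ∪ Y`. Other pairs keep
their status; the new vertex has a black edge to the common black neighbours of `X` and `Y`, no
edge to the vertices adjacent to neither, and a red edge to all other vertices. -/
def Trigraph.contract (H : Trigraph (Set V)) (X Y : Set V) : Trigraph (Set V) where
  verts := insert (X ∪ Y) (H.rest X Y)
  black := SimpleGraph.fromRel fun P Q =>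
    (P ∈ H.rest X Y ∧ Q ∈ H.rest X Y ∧ H.black.Adj P Q) ∨
    (P = X ∪ Y ∧ Q ∈ H.rest X Y ∧ (H.black.Adj X Q ∧ H.black.Adj Y Q))
  red := SimpleGraph.fromRel fun P Q =>
    (P ∈ H.rest X Y ∧ Q ∈ H.rest X Y ∧ H.red.Adj P Q) ∨
    (P = X ∪ Y ∧ Q ∈ H.rest X Y ∧ ¬ (H.black.Adj X Q ∧ H.black.Adj Y Q) ∧
      (H.black.Adj X Q ∨ H.red.Adj X Q ∨ H.black.Adj Y Q ∨ H.red.Adj Y Q))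
  disjoint := by
    have hne : ∀ P, P ∈ H.rest X Y → P ≠ X ∪ Y := by
      intro P hP h
      exact hP.2 (by simp [h])
    have hd : ∀ P Q, H.black.Adj P Q → ¬ H.red.Adj P Q := by
      intro P Q hb hr
      exact (SimpleGraph.disjoint_left.1 H.disjoint) P Q hb hr
    rw [SimpleGraph.disjoint_left]
    intro P Q hb hr
    rw [SimpleGraph.fromRel_adj] at hb hr
    obtain ⟨-, hb⟩ := hb
    obtain ⟨-, hr⟩ := hr
    rcases hb with (⟨p1, p2, p3⟩ | ⟨p1, p2, p3⟩) | (⟨p1, p2, p3⟩ | ⟨p1, p2, p3⟩) <;>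
      rcases hr with (⟨q1, q2, q3⟩ | ⟨q1, q2, q3⟩) | (⟨q1, q2, q3⟩ | ⟨q1, q2, q3⟩) <;>
      first
        | exact hd _ _ p3 q3
        | exact hd _ _ p3 q3.symm
        | exact q3.1 p3
        | exact hne _ p1 q1
        | exact hne _ p2 q1
        | exact hne _ q1 p1
        | exact hne _ q2 p1
  black_mem := by
    intro P Q h
    rw [SimpleGraph.fromRel_adj] at h
    rcases h with ⟨-, (h | h) | (h | h)⟩
    · exact Or.inr h.1
    · exact Or.inl h.1
    · exact Or.inr h.2.1
    · exact Or.inr h.2.1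
  red_mem := by
    intro P Q h
    rw [SimpleGraph.fromRel_adj] at h
    rcases h with ⟨-, (h | h) | (h | h)⟩
    · exact Or.inr h.1
    · exact Or.inl h.1
    · exact Or.inr h.2.1
    · exact Or.inr h.2.1

/-- `T n, …, T 1`, where `n` is the number of vertices of `G`, is a contraction sequence of `G`.
(The values of `T` at other indices are irrelevant; if `n ≥ 1` then `T 1` has a single vertex.) -/
def IsContractionSequence (G : SimpleGraph V) (T : ℕ → Trigraph (Set V)) : Prop :=
  T (Nat.card V) = Trigraph.ofGraph G ∧
    ∀ i, 1 ≤ i → i < Nat.card V →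
      ∃ X ∈ (T (i + 1)).verts, ∃ Y ∈ (T (i + 1)).verts, X ≠ Y ∧ T i = (T (i + 1)).contract X Y

/-- A `d`-sequence: a contraction sequence all of whose trigraphs have red degree at most `d`. -/
def IsDSequence (G : SimpleGraph V) (d : ℕ) (T : ℕ → Trigraph (Set V)) : Prop :=
  IsContractionSequence G T ∧
    ∀ i, 1 ≤ i → i ≤ Nat.card V → ∀ X ∈ (T i).verts, (T i).redDegree X ≤ d

/-- The twin-width of a (finite) graph. -/
noncomputable def twinWidth (G : SimpleGraph V) : ℕ :=
  sInf {d | ∃ T, IsDSequence G d T}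

/-- The vertex of `H` into which the original vertex `v` has been contracted is incident to a
red edge. -/
def IsRedIncident (H : Trigraph (Set V)) (v : V) : Prop :=
  ∃ X ∈ H.verts, v ∈ X ∧ ∃ Y, H.red.Adj X Y

/-- `s` is the last vertex to become incident to a red edge along `T n, …, T 1`: it becomes
incident to a red edge for the first time in some `T t`, and every vertex has become incident to a
red edge at that moment. -/
def IsLastRedIncident (T : ℕ → Trigraph (Set V)) (s : V) : Prop :=
  ∃ t, 1 ≤ t ∧ t ≤ Nat.card V ∧ IsRedIncident (T t) s ∧
    (∀ j, t < j → j ≤ Nat.card V → ¬ IsRedIncident (T j) s) ∧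
    ∀ v, ∃ j, t ≤ j ∧ j ≤ Nat.card V ∧ IsRedIncident (T j) v

/-- `side G s true` is the set of neighbours of `s`, and `side G s false` is the set of vertices
other than `s` that are not adjacent to `s`. -/
def side (G : SimpleGraph V) (s : V) : Bool → Set V
  | true => {v | G.Adj s v}
  | false => {v | v ≠ s ∧ ¬ G.Adj s v}

end Sequences

end TwinWidthOne

open TwinWidthOne

/-! A contraction sequence is a sequence of coarser and coarser partitions of the vertex set, whose
red edges are the mixed pairs of parts; a `1`-sequence is one in which every part is mixed with at
most one other (`IsDSequence.chain`). In a prime graph every part that is neither a single vertex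
nor everything is mixed with some other part. Hence, when `s` becomes red last, the red edges form a
perfect matching, which only two parts can satisfy, and one step earlier the partition is `{s}`,
`N(s)` and the non-neighbours (`exists_chain_sides`).

An end of `σ` has its two sides as intervals of `τ`. Call a set good if it is an interval of `σ`
whose trace on each side is an interval of `τ`; a vertex outside a good set splits neither trace.
The complement of `s` is good, and it is shrunk one vertex at a time. Consider the first partition
in which each trace lies in one part, and the merge of `X` and `Y` that produced it. If one of them
is mixed with the opposite trace, degree one and primality make the other meet the set in a single
removable vertex. Otherwise the opposite trace is a single vertex `q` (`Good.stuck_or_sdiff`).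

Once one side is reduced to `q`, the other trace `P` is split by `q` alone and is covered by two
parts whose traces on `P` are not split by `q`. A decomposable `P` on at least three vertices can
lose a `σ`-extremal vertex (`Stuck.exists_sdiff_singleton`). The process ends with `M` a pair of
twins or indecomposable, and in the latter case `M` is a prime node by Gallai's theorem. The
removals, reversed, give the ordering `π`.

No prime node contains a removed vertex (`Grow.subset_of_isPrimeNode`), and an indecomposable `M`
contains no smaller prime node because of degree one (`Stuck.eq_of_subset`); this is the uniqueness.
The chain restricted to `M ∪ {q}` ends with two parts and `{q}`, which gives the required
`1`-sequence (`Stuck.exists_seq`). -/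

namespace TwinWidthOne

/-! ### Contraction sequences as chains of partitions -/

section Partitions

variable {V : Type*}

/-- `v` is adjacent to all or to none of the vertices of `N`. -/
def Homog (G : SimpleGraph V) (v : V) (N : Set V) : Prop :=
  (∀ a ∈ N, G.Adj v a) ∨ ∀ a ∈ N, ¬ G.Adj v a

/-- There are both an edge and a non-edge between `P` and `Q`. -/
def Mixed (G : SimpleGraph V) (P Q : Set V) : Prop :=
  (∃ a ∈ P, ∃ b ∈ Q, G.Adj a b) ∧ ∃ a ∈ P, ∃ b ∈ Q, ¬ G.Adj a b

theorem Mixed.symm {G : SimpleGraph V} {P Q : Set V} (h : Mixed G P Q) : Mixed G Q P := by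
  obtain ⟨⟨a, ha, b, hb, h1⟩, c, hc, d, hd, h2⟩ := h
  exact ⟨⟨b, hb, a, ha, h1.symm⟩, d, hd, c, hc, fun h => h2 h.symm⟩

theorem Mixed.mono {G : SimpleGraph V} {P Q P' Q' : Set V} (h : Mixed G P Q) (hP : P ⊆ P')
    (hQ : Q ⊆ Q') : Mixed G P' Q' := by
  obtain ⟨⟨a, ha, b, hb, h1⟩, c, hc, d, hd, h2⟩ := h
  exact ⟨⟨a, hP ha, b, hQ hb, h1⟩, c, hP hc, d, hQ hd, h2⟩

/-- The trigraph on the parts of a partition, with red edges between the mixed pairs of parts. -/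
def quotTrigraph (G : SimpleGraph V) (𝒜 : Set (Set V)) : Trigraph (Set V) where
  verts := 𝒜
  black :=
    { Adj := fun P Q => P ∈ 𝒜 ∧ Q ∈ 𝒜 ∧ P ≠ Q ∧ ∀ a ∈ P, ∀ b ∈ Q, G.Adj a b
      symm := ⟨fun P Q ⟨hP, hQ, h, hA⟩ =>
        ⟨hQ, hP, h.symm, fun a ha b hb => (hA b hb a ha).symm⟩⟩
      loopless := ⟨fun P h => h.2.2.1 rfl⟩ }
  red :=
    { Adj := fun P Q => P ∈ 𝒜 ∧ Q ∈ 𝒜 ∧ P ≠ Q ∧ Mixed G P Q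
      symm := ⟨fun P Q ⟨hP, hQ, h, hA⟩ => ⟨hQ, hP, h.symm, hA.symm⟩⟩
      loopless := ⟨fun P h => h.2.2.1 rfl⟩ }
  disjoint := by
    rw [SimpleGraph.disjoint_left]
    rintro P Q ⟨-, -, -, h⟩ ⟨-, -, -, -, a, ha, b, hb, hn⟩
    exact hn (h a ha b hb)
  black_mem := fun _ _ h => h.1
  red_mem := fun _ _ h => h.1

theorem quotTrigraph_red {G : SimpleGraph V} {𝒜 : Set (Set V)} {P Q : Set V} :
    (quotTrigraph G 𝒜).red.Adj P Q ↔ P ∈ 𝒜 ∧ Q ∈ 𝒜 ∧ P ≠ Q ∧ Mixed G P Q := Iff.rfl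

theorem quotTrigraph_black {G : SimpleGraph V} {𝒜 : Set (Set V)} {P Q : Set V} :
    (quotTrigraph G 𝒜).black.Adj P Q ↔
      P ∈ 𝒜 ∧ Q ∈ 𝒜 ∧ P ≠ Q ∧ ∀ a ∈ P, ∀ b ∈ Q, G.Adj a b := Iff.rfl

/-- The partition into singletons. -/
def singletonParts (V : Type*) : Set (Set V) := Set.range fun v : V => ({v} : Set V)

/-- Merge two parts of a partition. -/
def mergeParts (𝒜 : Set (Set V)) (X Y : Set V) : Set (Set V) :=
  insert (X ∪ Y) (𝒜 \ {X, Y, X ∪ Y})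

/-- Every part is mixed with at most one other part. -/
def Deg1 (G : SimpleGraph V) (𝒜 : Set (Set V)) : Prop :=
  ∀ P ∈ 𝒜, ∀ Q ∈ 𝒜, ∀ R ∈ 𝒜, P ≠ Q → P ≠ R → Mixed G P Q → Mixed G P R → Q = R

/-- The members of `𝒜` are nonempty, cover the vertex set and are pairwise disjoint. -/
def IsParts (𝒜 : Set (Set V)) : Prop :=
  (∀ P ∈ 𝒜, P.Nonempty) ∧ (∀ v, ∃ P ∈ 𝒜, v ∈ P) ∧ ∀ P ∈ 𝒜, ∀ Q ∈ 𝒜, ∀ v ∈ P, v ∈ Q → P = Q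

/-- Every member of `𝒜` is contained in a member of `𝒬`. -/
def Refines (𝒜 𝒬 : Set (Set V)) : Prop := ∀ P ∈ 𝒜, ∃ Q ∈ 𝒬, P ⊆ Q

theorem Refines.refl (𝒜 : Set (Set V)) : Refines 𝒜 𝒜 := fun P hP => ⟨P, hP, subset_rfl⟩

theorem Refines.trans {𝒜 𝒬 ℛ : Set (Set V)} (h : Refines 𝒜 𝒬) (h' : Refines 𝒬 ℛ) :
    Refines 𝒜 ℛ := by
  intro P hP
  obtain ⟨Q, hQ, hPQ⟩ := h P hP
  obtain ⟨R, hR, hQR⟩ := h' Q hQ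
  exact ⟨R, hR, hPQ.trans hQR⟩

/-- Partitions reached from the singletons by merges that keep the red degree at most one. -/
inductive Chain (G : SimpleGraph V) : Set (Set V) → Prop
  | singles : Chain G (singletonParts V)
  | merge {𝒜 : Set (Set V)} {X Y : Set V} : Chain G 𝒜 → X ∈ 𝒜 → Y ∈ 𝒜 → X ≠ Y →
      Deg1 G (mergeParts 𝒜 X Y) → Chain G (mergeParts 𝒜 X Y)

theorem isParts_singles : IsParts (singletonParts V) := by
  refine ⟨?_, fun v => ⟨{v}, ⟨v, rfl⟩, rfl⟩, ?_⟩
  · rintro _ ⟨v, rfl⟩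
    exact ⟨v, rfl⟩
  · rintro _ ⟨u, rfl⟩ _ ⟨v, rfl⟩ w hu hv
    rw [Set.mem_singleton_iff] at hu hv
    rw [← hu, ← hv]

theorem refines_merge (𝒜 : Set (Set V)) (X Y : Set V) : Refines 𝒜 (mergeParts 𝒜 X Y) := by
  intro P hP
  by_cases h : P ∈ ({X, Y, X ∪ Y} : Set (Set V))
  · refine ⟨X ∪ Y, Or.inl rfl, ?_⟩
    rcases h with rfl | rfl | rfl
    exacts [Set.subset_union_left, Set.subset_union_right, subset_rfl]
  · exact ⟨P, Or.inr ⟨hP, h⟩, subset_rfl⟩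

theorem IsParts.union_notMem {𝒜 : Set (Set V)} (h : IsParts 𝒜) {X Y : Set V} (hX : X ∈ 𝒜)
    (hY : Y ∈ 𝒜) (hXY : X ≠ Y) : X ∪ Y ∉ 𝒜 := by
  intro hU
  obtain ⟨x, hx⟩ := h.1 X hX
  obtain ⟨y, hy⟩ := h.1 Y hY
  exact hXY ((h.2.2 X hX _ hU x hx (Or.inl hx)).trans (h.2.2 Y hY _ hU y hy (Or.inr hy)).symm)

theorem IsParts.merge {𝒜 : Set (Set V)} (h : IsParts 𝒜) {X Y : Set V} (hX : X ∈ 𝒜)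
    (hY : Y ∈ 𝒜) : IsParts (mergeParts 𝒜 X Y) := by
  have key : ∀ Q ∈ 𝒜 \ {X, Y, X ∪ Y}, ∀ v ∈ X ∪ Y, v ∉ Q := by
    rintro Q ⟨hQ, hne⟩ v (hv | hv) hvQ
    · exact hne (Or.inl (h.2.2 Q hQ X hX v hvQ hv))
    · exact hne (Or.inr (Or.inl (h.2.2 Q hQ Y hY v hvQ hv)))
  refine ⟨?_, ?_, ?_⟩
  · rintro P (rfl | hP)
    · exact (h.1 X hX).mono Set.subset_union_left
    · exact h.1 P hP.1
  · intro v
    obtain ⟨P, hP, hv⟩ := h.2.1 v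
    obtain ⟨Q, hQ, hPQ⟩ := refines_merge 𝒜 X Y P hP
    exact ⟨Q, hQ, hPQ hv⟩
  · rintro P (rfl | hP) Q (rfl | hQ) v hvP hvQ
    · rfl
    · exact (key Q hQ v hvP hvQ).elim
    · exact (key P hP v hvQ hvP).elim
    · exact h.2.2 P hP.1 Q hQ.1 v hvP hvQ

theorem Chain.isParts {G : SimpleGraph V} {𝒜 : Set (Set V)} (h : Chain G 𝒜) : IsParts 𝒜 := by
  induction h with
  | singles => exact isParts_singles
  | merge _ hX hY _ _ ih => exact ih.merge hX hY

theorem deg1_singles (G : SimpleGraph V) : Deg1 G (singletonParts V) := by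
  rintro _ ⟨p, rfl⟩ _ ⟨q, rfl⟩ _ _ _ _ ⟨⟨a, ha, b, hb, h1⟩, c, hc, d, hd, h2⟩ _
  rw [Set.mem_singleton_iff] at ha hb hc hd
  subst ha hb hc hd
  exact (h2 h1).elim

theorem Chain.deg1 {G : SimpleGraph V} {𝒜 : Set (Set V)} (h : Chain G 𝒜) : Deg1 G 𝒜 := by
  cases h with
  | singles => exact deg1_singles G
  | merge _ _ _ _ hd => exact hd

/-- A property of the initial partition that fails for a later one fails first after some merge. -/
theorem Chain.exists_step {G : SimpleGraph V} {𝒬 : Set (Set V)} (h : Chain G 𝒬)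
    (φ : Set (Set V) → Prop) (h0 : φ (singletonParts V)) (h1 : ¬ φ 𝒬) :
    ∃ (𝒜 : Set (Set V)) (X Y : Set V), X ∈ 𝒜 ∧ Y ∈ 𝒜 ∧ X ≠ Y ∧ Chain G 𝒜 ∧ φ 𝒜 ∧
      ¬ φ (mergeParts 𝒜 X Y) ∧ Chain G (mergeParts 𝒜 X Y) ∧
      Refines (mergeParts 𝒜 X Y) 𝒬 := by
  induction h with
  | singles => exact (h1 h0).elim
  | @merge 𝒜 X Y hc hX hY hXY hd ih =>
    by_cases hφ : φ 𝒜
    · exact ⟨𝒜, X, Y, hX, hY, hXY, hc, hφ, h1, hc.merge hX hY hXY hd, Refines.refl _⟩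
    · obtain ⟨𝒜', X', Y', a1, a2, a3, a4, a5, a6, a7, a8⟩ := ih hφ
      exact ⟨𝒜', X', Y', a1, a2, a3, a4, a5, a6, a7, a8.trans (refines_merge _ _ _)⟩

theorem trigraph_ext {α : Type*} {H K : Trigraph α} (h1 : H.verts = K.verts)
    (h2 : H.black = K.black) (h3 : H.red = K.red) : H = K := by
  cases H; cases K; cases h1; cases h2; cases h3; rfl

theorem ofGraph_eq (G : SimpleGraph V) : Trigraph.ofGraph G = quotTrigraph G (singletonParts V) := by
  refine trigraph_ext rfl ?_ ?_
  · ext P Q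
    rw [quotTrigraph_black]
    simp only [Trigraph.ofGraph, SimpleGraph.fromRel_adj]
    constructor
    · rintro ⟨hne, ⟨u, v, rfl, rfl, h⟩ | ⟨u, v, rfl, rfl, h⟩⟩
      · exact ⟨⟨u, rfl⟩, ⟨v, rfl⟩, hne, by rintro a rfl b rfl; exact h⟩
      · exact ⟨⟨v, rfl⟩, ⟨u, rfl⟩, hne, by rintro a rfl b rfl; exact h.symm⟩
    · rintro ⟨⟨u, rfl⟩, ⟨v, rfl⟩, hne, h⟩
      exact ⟨hne, Or.inl ⟨u, v, rfl, rfl, h u rfl v rfl⟩⟩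
  · ext P Q
    rw [quotTrigraph_red]
    simp only [Trigraph.ofGraph, SimpleGraph.bot_adj, false_iff]
    rintro ⟨⟨u, rfl⟩, ⟨v, rfl⟩, -, ⟨a, rfl, b, rfl, h1⟩, c, rfl, d, rfl, h2⟩
    exact h2 h1

/-- Black, absent and red between two parts mean all edges, no edges and mixed, whatever the order
of the contractions. A trigraph of the sequence therefore depends only on its partition. -/
theorem contract_eq (G : SimpleGraph V) {𝒜 : Set (Set V)} (hp : IsParts 𝒜) {X Y : Set V}
    (hX : X ∈ 𝒜) (hY : Y ∈ 𝒜) :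
    (quotTrigraph G 𝒜).contract X Y = quotTrigraph G (mergeParts 𝒜 X Y) := by
  have hr : ∀ Q, Q ∈ (quotTrigraph G 𝒜).rest X Y ↔ Q ∈ 𝒜 ∧ Q ≠ X ∧ Q ≠ Y ∧ Q ≠ X ∪ Y := by
    intro Q
    simp [Trigraph.rest, quotTrigraph]
  have hm : ∀ Q, Q ∈ mergeParts 𝒜 X Y ↔ Q = X ∪ Y ∨ Q ∈ (quotTrigraph G 𝒜).rest X Y := by
    intro Q
    rfl
  have hbl : ∀ Q ∈ (quotTrigraph G 𝒜).rest X Y,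
      ((quotTrigraph G 𝒜).black.Adj X Q ∧ (quotTrigraph G 𝒜).black.Adj Y Q ↔
        ∀ a ∈ X ∪ Y, ∀ b ∈ Q, G.Adj a b) := by
    intro Q hQ
    rw [hr] at hQ
    simp only [quotTrigraph_black]
    constructor
    · rintro ⟨⟨-, -, -, h1⟩, -, -, -, h2⟩ a (ha | ha) b hb
      exacts [h1 a ha b hb, h2 a ha b hb]
    · intro h
      exact ⟨⟨hX, hQ.1, hQ.2.1.symm, fun a ha => h a (Or.inl ha)⟩, hY, hQ.1, hQ.2.2.1.symm,
        fun a ha => h a (Or.inr ha)⟩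
  have hex : ∀ Z ∈ 𝒜, ∀ Q ∈ 𝒜, Z ≠ Q → ((quotTrigraph G 𝒜).black.Adj Z Q ∨
      (quotTrigraph G 𝒜).red.Adj Z Q ↔ ∃ a ∈ Z, ∃ b ∈ Q, G.Adj a b) := by
    intro Z hZ Q hQ hne
    rw [quotTrigraph_black, quotTrigraph_red]
    constructor
    · rintro (⟨-, -, -, h⟩ | ⟨-, -, -, h⟩)
      · obtain ⟨a, ha⟩ := hp.1 Z hZ
        obtain ⟨b, hb⟩ := hp.1 Q hQ
        exact ⟨a, ha, b, hb, h a ha b hb⟩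
      · exact h.1
    · intro h
      by_cases h' : ∀ a ∈ Z, ∀ b ∈ Q, G.Adj a b
      · exact Or.inl ⟨hZ, hQ, hne, h'⟩
      · push Not at h'
        exact Or.inr ⟨hZ, hQ, hne, h, h'⟩
  have hrd : ∀ Q ∈ (quotTrigraph G 𝒜).rest X Y,
      (¬ ((quotTrigraph G 𝒜).black.Adj X Q ∧ (quotTrigraph G 𝒜).black.Adj Y Q) ∧
      ((quotTrigraph G 𝒜).black.Adj X Q ∨ (quotTrigraph G 𝒜).red.Adj X Q ∨
        (quotTrigraph G 𝒜).black.Adj Y Q ∨ (quotTrigraph G 𝒜).red.Adj Y Q) ↔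
        Mixed G (X ∪ Y) Q) := by
    intro Q hQ
    rw [hbl Q hQ]
    rw [hr] at hQ
    rw [← or_assoc, hex X hX Q hQ.1 hQ.2.1.symm, hex Y hY Q hQ.1 hQ.2.2.1.symm]
    unfold Mixed
    push Not
    constructor
    · rintro ⟨h1, ⟨a, ha, h2⟩ | ⟨a, ha, h2⟩⟩
      exacts [⟨⟨a, Or.inl ha, h2⟩, h1⟩, ⟨⟨a, Or.inr ha, h2⟩, h1⟩]
    · rintro ⟨⟨a, ha | ha, h2⟩, h1⟩
      exacts [⟨h1, Or.inl ⟨a, ha, h2⟩⟩, ⟨h1, Or.inr ⟨a, ha, h2⟩⟩]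
  have hne : ∀ Q ∈ (quotTrigraph G 𝒜).rest X Y, Q ≠ X ∪ Y := fun Q hQ => ((hr Q).1 hQ).2.2.2
  refine trigraph_ext rfl ?_ ?_
  · ext P Q
    rw [quotTrigraph_black]
    simp only [Trigraph.contract, SimpleGraph.fromRel_adj]
    constructor
    · rintro ⟨hPQ, (⟨h1, h2, h3⟩ | ⟨rfl, h2, h3⟩) | (⟨h1, h2, h3⟩ | ⟨rfl, h2, h3⟩)⟩
      · exact ⟨Or.inr h1, Or.inr h2, hPQ, h3.2.2.2⟩
      · exact ⟨Or.inl rfl, Or.inr h2, hPQ, (hbl Q h2).1 h3⟩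
      · exact ⟨Or.inr h2, Or.inr h1, hPQ, h3.symm.2.2.2⟩
      · exact ⟨Or.inr h2, Or.inl rfl, hPQ, fun a ha b hb => ((hbl P h2).1 h3 b hb a ha).symm⟩
    · rintro ⟨hP, hQ, hPQ, h⟩
      refine ⟨hPQ, ?_⟩
      rw [hm] at hP hQ
      rcases hP with rfl | hP <;> rcases hQ with rfl | hQ
      · exact (hPQ rfl).elim
      · exact Or.inl (Or.inr ⟨rfl, hQ, (hbl Q hQ).2 h⟩)
      · exact Or.inr (Or.inr ⟨rfl, hP, (hbl P hP).2 fun a ha b hb => (h b hb a ha).symm⟩)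
      · exact Or.inl (Or.inl ⟨hP, hQ, hP.1, hQ.1, hPQ, h⟩)
  · ext P Q
    rw [quotTrigraph_red]
    simp only [Trigraph.contract, SimpleGraph.fromRel_adj]
    constructor
    · rintro ⟨hPQ, (⟨h1, h2, h3⟩ | ⟨rfl, h2, h3⟩) | (⟨h1, h2, h3⟩ | ⟨rfl, h2, h3⟩)⟩
      · exact ⟨Or.inr h1, Or.inr h2, hPQ, h3.2.2.2⟩
      · exact ⟨Or.inl rfl, Or.inr h2, hPQ, (hrd Q h2).1 h3⟩
      · exact ⟨Or.inr h2, Or.inr h1, hPQ, h3.symm.2.2.2⟩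
      · exact ⟨Or.inr h2, Or.inl rfl, hPQ, ((hrd P h2).1 h3).symm⟩
    · rintro ⟨hP, hQ, hPQ, h⟩
      refine ⟨hPQ, ?_⟩
      rw [hm] at hP hQ
      rcases hP with rfl | hP <;> rcases hQ with rfl | hQ
      · exact (hPQ rfl).elim
      · exact Or.inl (Or.inr ⟨rfl, hQ, (hrd Q hQ).2 h⟩)
      · exact Or.inr (Or.inr ⟨rfl, hP, (hrd P hP).2 h.symm⟩)
      · exact Or.inl (Or.inl ⟨hP, hQ, hP.1, hQ.1, hPQ, h⟩)

theorem redDegree_le_one_iff [Finite V] {G : SimpleGraph V} {𝒜 : Set (Set V)} :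
    (∀ X ∈ (quotTrigraph G 𝒜).verts, (quotTrigraph G 𝒜).redDegree X ≤ 1) ↔ Deg1 G 𝒜 := by
  constructor
  · intro h P hP Q hQ R hR h1 h2 h3 h4
    exact (Set.ncard_le_one_iff (Set.toFinite _)).1 (h P hP) ⟨hP, hQ, h1, h3⟩ ⟨hP, hR, h2, h4⟩
  · intro h P hP
    refine (Set.ncard_le_one_iff (Set.toFinite _)).2 fun {Q R} hQ hR => ?_
    exact h P hP Q hQ.2.1 R hR.2.1 hQ.2.2.1 hR.2.2.1 hQ.2.2.2 hR.2.2.2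

theorem ncard_singles [Finite V] : (singletonParts V).ncard = Nat.card V := by
  rw [singletonParts, ← Set.image_univ, Set.ncard_image_of_injective _ Set.singleton_injective,
    Set.ncard_univ]

theorem IsParts.ncard_merge [Finite V] {𝒜 : Set (Set V)} (h : IsParts 𝒜) {X Y : Set V}
    (hX : X ∈ 𝒜) (hY : Y ∈ 𝒜) (hXY : X ≠ Y) : (mergeParts 𝒜 X Y).ncard + 1 = 𝒜.ncard := by
  have hU := h.union_notMem hX hY hXY
  have h1 : 𝒜 \ {X, Y, X ∪ Y} = (𝒜 \ {Y}) \ {X} := by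
    ext Q
    simp only [Set.mem_sdiff, Set.mem_insert_iff, Set.mem_singleton_iff, not_or]
    constructor
    · rintro ⟨a, b, c, -⟩
      exact ⟨⟨a, c⟩, b⟩
    · rintro ⟨⟨a, c⟩, b⟩
      exact ⟨a, b, c, fun hh => hU (hh ▸ a)⟩
  rw [mergeParts, Set.ncard_insert_of_notMem (fun hh => hU hh.1), h1,
    Set.ncard_sdiff_singleton_add_one (show X ∈ 𝒜 \ {Y} from ⟨hX, hXY⟩),
    Set.ncard_sdiff_singleton_add_one hY]

/-- The trigraphs of a `1`-sequence are quotients by partitions reached by merges. -/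
theorem IsDSequence.chain [Finite V] {G : SimpleGraph V} {T : ℕ → Trigraph (Set V)}
    (hT : IsDSequence G 1 T) (i : ℕ) (h1 : 1 ≤ i) (hi : i ≤ Nat.card V) :
    Chain G (T i).verts ∧ T i = quotTrigraph G (T i).verts ∧ (T i).verts.ncard = i := by
  induction hi using Nat.decreasingInduction with
  | self =>
    rw [hT.1.1, ofGraph_eq]
    exact ⟨Chain.singles, rfl, ncard_singles⟩
  | of_succ i hi ih =>
    obtain ⟨hc, he, hn⟩ := ih (by omega)
    obtain ⟨X, hX, Y, hY, hXY, hs⟩ := hT.1.2 i h1 hi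
    have hs' : T i = quotTrigraph G (mergeParts (T (i + 1)).verts X Y) := by
      rw [hs]
      conv_lhs => rw [he]
      exact contract_eq G hc.isParts hX hY
    have hd : Deg1 G (mergeParts (T (i + 1)).verts X Y) := by
      rw [← redDegree_le_one_iff, ← hs']
      exact hT.2 i h1 hi.le
    have hv : (T i).verts = mergeParts (T (i + 1)).verts X Y := by rw [hs']; rfl
    refine ⟨by rw [hv]; exact hc.merge hX hY hXY hd, by rw [hv]; exact hs', ?_⟩
    have := hc.isParts.ncard_merge hX hY hXY
    rw [hv]
    omega

theorem IsDSequence.refines [Finite V] {G : SimpleGraph V} {T : ℕ → Trigraph (Set V)}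
    (hT : IsDSequence G 1 T) {i j : ℕ} (h1 : 1 ≤ i) (hij : i ≤ j) (hj : j ≤ Nat.card V) :
    Refines (T j).verts (T i).verts := by
  induction j, hij using Nat.le_induction with
  | base => exact Refines.refl _
  | succ j hij ih =>
    obtain ⟨X, hX, Y, hY, hXY, hs⟩ := hT.1.2 j (by omega) (by omega)
    have : Refines (T (j + 1)).verts (T j).verts := by
      rw [hs]
      exact refines_merge _ _ _
    exact this.trans (ih (by omega))

/-- A chain of merges gives the initial part of a `1`-sequence. -/
theorem Chain.exists_seq [Finite V] {G : SimpleGraph V} {𝒬 : Set (Set V)} (h : Chain G 𝒬) :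
    ∃ 𝒯 : ℕ → Set (Set V), 𝒯 (Nat.card V) = singletonParts V ∧ 𝒯 𝒬.ncard = 𝒬 ∧
      𝒬.ncard ≤ Nat.card V ∧
      ∀ i, 𝒬.ncard ≤ i → i ≤ Nat.card V → Chain G (𝒯 i) ∧ Refines (𝒯 i) 𝒬 ∧
        (i < Nat.card V → ∃ X ∈ 𝒯 (i + 1), ∃ Y ∈ 𝒯 (i + 1), X ≠ Y ∧
          𝒯 i = mergeParts (𝒯 (i + 1)) X Y) := by
  induction h with
  | singles =>
    refine ⟨fun _ => singletonParts V, rfl, rfl, ncard_singles.le, fun i h1 h2 => ?_⟩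
    rw [ncard_singles] at h1
    exact ⟨Chain.singles, Refines.refl _, fun h => by omega⟩
  | @merge 𝒜 X Y hc hX hY hXY hd ih =>
    obtain ⟨𝒯, h1, h2, h3, h4⟩ := ih
    have hn := hc.isParts.ncard_merge hX hY hXY
    -- The index counts the parts, so the new partition goes one place below the previous one.
    refine ⟨Function.update 𝒯 (mergeParts 𝒜 X Y).ncard (mergeParts 𝒜 X Y),
      ?_, ?_, by omega, ?_⟩
    · rw [Function.update_of_ne (by omega), h1]
    · rw [Function.update_self]
    · intro i hi hi'
      rcases hi.eq_or_lt with rfl | hlt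
      · rw [Function.update_self, Function.update_of_ne (by omega), hn, h2]
        exact ⟨hc.merge hX hY hXY hd, Refines.refl _, fun _ => ⟨X, hX, Y, hY, hXY, rfl⟩⟩
      · rw [Function.update_of_ne (by omega), Function.update_of_ne (by omega)]
        obtain ⟨a, b, c⟩ := h4 i (by omega) hi'
        exact ⟨a, b.trans (refines_merge _ _ _), c⟩

/-- The partition induced on the domain of a map. -/
def pullParts {W : Type*} (f : W → V) (𝒜 : Set (Set V)) : Set (Set W) :=
  {N | N.Nonempty ∧ ∃ P ∈ 𝒜, f ⁻¹' P = N}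

theorem Mixed.of_preimage {W : Type*} {f : W → V} {G : SimpleGraph V} {P Q : Set V}
    (h : Mixed (G.comap f) (f ⁻¹' P) (f ⁻¹' Q)) : Mixed G P Q := by
  obtain ⟨⟨a, ha, b, hb, h1⟩, c, hc, d, hd, h2⟩ := h
  exact ⟨⟨f a, ha, f b, hb, h1⟩, f c, hc, f d, hd, h2⟩

theorem Deg1.pull {W : Type*} (f : W → V) {G : SimpleGraph V} {𝒜 : Set (Set V)}
    (h : Deg1 G 𝒜) : Deg1 (G.comap f) (pullParts f 𝒜) := by
  rintro _ ⟨-, P, hP, rfl⟩ _ ⟨-, Q, hQ, rfl⟩ _ ⟨-, R, hR, rfl⟩ h1 h2 h3 h4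
  rw [h P hP Q hQ R hR (fun e => h1 (by rw [e])) (fun e => h2 (by rw [e])) h3.of_preimage
    h4.of_preimage]

theorem pull_singles {W : Type*} {f : W → V} (hf : Function.Injective f) :
    pullParts f (singletonParts V) = singletonParts W := by
  ext N
  constructor
  · rintro ⟨⟨w, hw⟩, _, ⟨v, rfl⟩, rfl⟩
    refine ⟨w, ?_⟩
    ext x
    simp only [Set.mem_preimage, Set.mem_singleton_iff] at hw ⊢
    rw [← hw, hf.eq_iff]
  · rintro ⟨w, rfl⟩
    refine ⟨⟨w, rfl⟩, {f w}, ⟨f w, rfl⟩, ?_⟩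
    ext x
    simp [hf.eq_iff]

/-- A merge either merges two traces or, when one of the parts misses the range of `f`, leaves the
induced partition unchanged. This restricts chains to induced subgraphs. -/
theorem Chain.pull {W : Type*} {f : W → V} (hf : Function.Injective f) {G : SimpleGraph V}
    {𝒜 : Set (Set V)} (h : Chain G 𝒜) : Chain (G.comap f) (pullParts f 𝒜) := by
  induction h with
  | singles => rw [pull_singles hf]; exact Chain.singles
  | @merge 𝒜 X Y hc hX hY hXY hd ih =>
    have hp := hc.isParts
    by_cases hXe : (f ⁻¹' X).Nonempty
    · by_cases hYe : (f ⁻¹' Y).Nonempty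
      · have key : pullParts f (mergeParts 𝒜 X Y) =
            mergeParts (pullParts f 𝒜) (f ⁻¹' X) (f ⁻¹' Y) := by
          ext N
          constructor
          · rintro ⟨hN, Q, rfl | ⟨hQ, hQn⟩, rfl⟩
            · exact Or.inl rfl
            · refine Or.inr ⟨⟨hN, Q, hQ, rfl⟩, ?_⟩
              obtain ⟨w, hw⟩ := hN
              have hwX : f w ∉ X := fun hh => hQn (Or.inl (hp.2.2 Q hQ X hX _ hw hh))
              have hwY : f w ∉ Y := fun hh => hQn (Or.inr (Or.inl (hp.2.2 Q hQ Y hY _ hw hh)))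
              rintro (e | e | e)
              · exact hwX (show w ∈ f ⁻¹' X from e ▸ hw)
              · exact hwY (show w ∈ f ⁻¹' Y from e ▸ hw)
              · have : w ∈ f ⁻¹' X ∪ f ⁻¹' Y := by rw [← Set.mem_singleton_iff.1 e]; exact hw
                exact this.elim hwX hwY
          · rintro (rfl | ⟨⟨hN, Q, hQ, rfl⟩, hQn⟩)
            · exact ⟨hXe.mono Set.subset_union_left, X ∪ Y, Or.inl rfl, rfl⟩
            · refine ⟨hN, Q, Or.inr ⟨hQ, ?_⟩, rfl⟩
              rintro (rfl | rfl | e)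
              · exact hQn (Or.inl rfl)
              · exact hQn (Or.inr (Or.inl rfl))
              · rw [Set.mem_singleton_iff] at e
                exact hQn (Or.inr (Or.inr (by rw [e]; rfl)))
        rw [key]
        refine ih.merge ⟨hXe, X, hX, rfl⟩ ⟨hYe, Y, hY, rfl⟩ ?_ (by rw [← key]; exact hd.pull f)
        intro e
        obtain ⟨w, hw⟩ := hXe
        exact hXY (hp.2.2 X hX Y hY (f w) hw (show w ∈ f ⁻¹' Y from e ▸ hw))
      · have key : pullParts f (mergeParts 𝒜 X Y) = pullParts f 𝒜 := by
          rw [Set.not_nonempty_iff_eq_empty] at hYe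
          ext N
          constructor
          · rintro ⟨hN, Q, rfl | ⟨hQ, hQn⟩, rfl⟩
            · exact ⟨hN, X, hX, by rw [Set.preimage_union, hYe, Set.union_empty]⟩
            · exact ⟨hN, Q, hQ, rfl⟩
          · rintro ⟨hN, Q, hQ, rfl⟩
            by_cases hQX : Q = X
            · exact ⟨hN, X ∪ Y, Or.inl rfl,
                by rw [Set.preimage_union, hYe, Set.union_empty, hQX]⟩
            · refine ⟨hN, Q, Or.inr ⟨hQ, ?_⟩, rfl⟩
              rintro (e | rfl | e)
              · exact hQX e
              · rw [hYe] at hN; exact Set.not_nonempty_empty hN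
              · rw [Set.mem_singleton_iff] at e
                exact hp.union_notMem hX hY hXY (e ▸ hQ)
        rw [key]
        exact ih
    · have key : pullParts f (mergeParts 𝒜 X Y) = pullParts f 𝒜 := by
        rw [Set.not_nonempty_iff_eq_empty] at hXe
        ext N
        constructor
        · rintro ⟨hN, Q, rfl | ⟨hQ, hQn⟩, rfl⟩
          · exact ⟨hN, Y, hY, by rw [Set.preimage_union, hXe, Set.empty_union]⟩
          · exact ⟨hN, Q, hQ, rfl⟩
        · rintro ⟨hN, Q, hQ, rfl⟩
          by_cases hQY : Q = Y
          · exact ⟨hN, X ∪ Y, Or.inl rfl,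
              by rw [Set.preimage_union, hXe, Set.empty_union, hQY]⟩
          · refine ⟨hN, Q, Or.inr ⟨hQ, ?_⟩, rfl⟩
            rintro (rfl | e | e)
            · rw [hXe] at hN; exact Set.not_nonempty_empty hN
            · exact hQY e
            · rw [Set.mem_singleton_iff] at e
              exact hp.union_notMem hX hY hXY (e ▸ hQ)
      rw [key]
      exact ih

end Partitions

/-! ### The last vertex to become incident to a red edge -/

section LastRed

variable {V : Type*}

theorem quotTrigraph_redIncident {G : SimpleGraph V} {𝒜 : Set (Set V)} {v : V} :
    IsRedIncident (quotTrigraph G 𝒜) v ↔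
      ∃ X ∈ 𝒜, v ∈ X ∧ ∃ Y ∈ 𝒜, X ≠ Y ∧ Mixed G X Y := by
  constructor
  · rintro ⟨X, hX, hv, Y, -, hY, h1, h2⟩
    exact ⟨X, hX, hv, Y, hY, h1, h2⟩
  · rintro ⟨X, hX, hv, Y, hY, h1, h2⟩
    exact ⟨X, hX, hv, Y, hX, hY, h1, h2⟩

theorem not_homog_iff {G : SimpleGraph V} {v : V} {N : Set V} :
    ¬ Homog G v N ↔ (∃ a ∈ N, G.Adj v a) ∧ ∃ a ∈ N, ¬ G.Adj v a := by
  unfold Homog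
  push Not
  exact and_comm

theorem Homog.mono {G : SimpleGraph V} {v : V} {N N' : Set V} (h : Homog G v N) (hN : N' ⊆ N) :
    Homog G v N' :=
  h.imp (fun h a ha => h a (hN ha)) fun h a ha => h a (hN ha)

theorem mixed_singleton_iff {G : SimpleGraph V} {v : V} {N : Set V} :
    Mixed G {v} N ↔ ¬ Homog G v N := by
  rw [not_homog_iff]
  simp [Mixed]

theorem IsPrimeGraph.exists_not_homog {G : SimpleGraph V} (hG : IsPrimeGraph G) {N : Set V}
    (h : N.Nontrivial) (hu : N ≠ Set.univ) : ∃ v ∉ N, ¬ Homog G v N := by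
  by_contra hcon
  push Not at hcon
  rcases hG N hcon with h1 | h1
  · exact Set.not_subsingleton_iff.2 h h1
  · exact hu h1

theorem IsPrimeGraph.exists_mixed {G : SimpleGraph V} (hG : IsPrimeGraph G) {𝒜 : Set (Set V)}
    (hp : IsParts 𝒜) {X : Set V} (h : X.Nontrivial) (hu : X ≠ Set.univ) :
    ∃ Y ∈ 𝒜, X ≠ Y ∧ Mixed G X Y := by
  obtain ⟨v, hv, hm⟩ := hG.exists_not_homog h hu
  obtain ⟨Y, hY, hvY⟩ := hp.2.1 v
  refine ⟨Y, hY, fun e => hv (e ▸ hvY), ?_⟩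
  exact ((mixed_singleton_iff.2 hm).mono (Set.singleton_subset_iff.2 hvY) subset_rfl).symm

theorem IsParts.nontrivial_union {𝒜 : Set (Set V)} (hp : IsParts 𝒜) {X Y : Set V} (hX : X ∈ 𝒜)
    (hY : Y ∈ 𝒜) (hXY : X ≠ Y) : (X ∪ Y).Nontrivial := by
  obtain ⟨x, hx⟩ := hp.1 X hX
  obtain ⟨y, hy⟩ := hp.1 Y hY
  exact ⟨x, Or.inl hx, y, Or.inr hy, fun e => hXY (hp.2.2 X hX Y hY x hx (e ▸ hy))⟩

/-- In a perfect red matching on at least three parts no merge is possible. -/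
theorem not_deg1_merge {G : SimpleGraph V} (hG : IsPrimeGraph G) {𝒜 : Set (Set V)}
    (hp : IsParts 𝒜) (hd : Deg1 G 𝒜) (hfull : ∀ X ∈ 𝒜, ∃ Y ∈ 𝒜, X ≠ Y ∧ Mixed G X Y)
    {X Y Z : Set V} (hX : X ∈ 𝒜) (hY : Y ∈ 𝒜) (hZ : Z ∈ 𝒜) (hXY : X ≠ Y) (hZX : Z ≠ X)
    (hZY : Z ≠ Y) : ¬ Deg1 G (mergeParts 𝒜 X Y) := by
  intro hd'
  have hU := hp.union_notMem hX hY hXY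
  have hUm : X ∪ Y ∈ mergeParts 𝒜 X Y := Or.inl rfl
  have hne : ∀ Q ∈ 𝒜, X ∪ Y ≠ Q := fun Q hQ e => hU (e ▸ hQ)
  have hmem : ∀ Q ∈ 𝒜, Q ≠ X → Q ≠ Y → Q ∈ mergeParts 𝒜 X Y := by
    intro Q hQ h1 h2
    refine Or.inr ⟨hQ, ?_⟩
    rintro (e | e | e)
    exacts [h1 e, h2 e, hne Q hQ (Set.mem_singleton_iff.1 e).symm]
  -- `X` and `Y` are partners in the matching: otherwise their partners would both be mixed with `X
  -- ∪ Y`, hence coincide, and that common partner would be mixed with both `X` and `Y`.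
  have hXYm : Mixed G X Y := by
    obtain ⟨X', hX', hXX', hmX⟩ := hfull X hX
    obtain ⟨Y', hY', hYY', hmY⟩ := hfull Y hY
    by_cases h1 : X' = Y
    · exact h1 ▸ hmX
    by_cases h2 : Y' = X
    · exact (h2 ▸ hmY).symm
    have : X' = Y' := hd' _ hUm _ (hmem X' hX' hXX'.symm h1) _ (hmem Y' hY' h2 hYY'.symm)
      (hne _ hX') (hne _ hY') (hmX.mono Set.subset_union_left subset_rfl)
      (hmY.mono Set.subset_union_right subset_rfl)
    subst this
    exact (hXY (hd X' hX' X hX Y hY hXX'.symm hYY'.symm hmX.symm hmY.symm)).elim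
  have hUu : X ∪ Y ≠ Set.univ := by
    intro e
    obtain ⟨z, hz⟩ := hp.1 Z hZ
    rcases (e ▸ Set.mem_univ z : z ∈ X ∪ Y) with h | h
    exacts [hZX (hp.2.2 Z hZ X hX z hz h), hZY (hp.2.2 Z hZ Y hY z hz h)]
  -- By primality `X ∪ Y` is mixed with some `W`, which also keeps its old partner `W'` and so has
  -- red degree two.
  obtain ⟨W, hW, hUW, hmW⟩ :=
    hG.exists_mixed (hp.merge hX hY) (hp.nontrivial_union hX hY hXY) hUu
  rcases hW with rfl | ⟨hW', hWn⟩
  · exact hUW rfl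
  simp only [Set.mem_insert_iff, Set.mem_singleton_iff, not_or] at hWn
  obtain ⟨W', hW'', hWW', hmW'⟩ := hfull W hW'
  have h1 : W' ≠ X := by
    rintro rfl
    exact hWn.2.1 (hd W' hX W hW' Y hY hWW'.symm hXY hmW'.symm hXYm)
  have h2 : W' ≠ Y := by
    rintro rfl
    exact hWn.1 (hd W' hY W hW' X hX hWW'.symm hXY.symm hmW'.symm hXYm.symm)
  exact hne W' hW'' (hd' W (hmem W hW' hWn.1 hWn.2.1) _ hUm _ (hmem W' hW'' h1 h2) hUW.symm hWW'
    hmW.symm hmW')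

/-- If `s` is the last vertex to become incident to a red edge, then the sequence passes through
the partition into `{s}` and its two sides. -/
theorem exists_chain_sides [Finite V] {G : SimpleGraph V} (hG : IsPrimeGraph G) {s : V}
    {T : ℕ → Trigraph (Set V)} (hT : IsDSequence G 1 T) (hs : IsLastRedIncident T s) :
    ∃ 𝒬, Chain G 𝒬 ∧ {s} ∈ 𝒬 ∧ ∀ i, side G s i ∈ 𝒬 := by
  obtain ⟨t, ht1, htn, hred, hbefore, hall⟩ := hs
  have hredI : ∀ i, 1 ≤ i → i ≤ Nat.card V → ∀ v, IsRedIncident (T i) v ↔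
      ∃ X ∈ (T i).verts, v ∈ X ∧ ∃ Y ∈ (T i).verts, X ≠ Y ∧ Mixed G X Y := by
    intro i h1 h2 v
    conv_lhs => rw [(hT.chain i h1 h2).2.1]
    exact quotTrigraph_redIncident
  obtain ⟨hc, -, hcard⟩ := hT.chain t ht1 htn
  have hp := hc.isParts
  obtain ⟨S, hS, hsS, R, hR, hSR, hSRm⟩ := (hredI t ht1 htn s).1 hred
  have huniv : ∀ X ∈ (T t).verts, X ≠ Set.univ := by
    rintro X hX rfl
    obtain ⟨r, hr⟩ := hp.1 R hR
    exact hSR ((hp.2.2 S hS _ hX s hsS trivial).trans (hp.2.2 R hR _ hX r hr trivial).symm)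
  -- Primality handles the larger parts. A part `{v}` has never been merged, so a red edge met
  -- earlier at `v` persists, since parts only grow.
  have hfull : ∀ X ∈ (T t).verts, ∃ Y ∈ (T t).verts, X ≠ Y ∧ Mixed G X Y := by
    intro X hX
    by_cases hnt : X.Nontrivial
    · exact hG.exists_mixed hp hnt (huniv X hX)
    obtain ⟨v, rfl⟩ := (Set.not_nontrivial_iff.1 hnt).eq_empty_or_singleton.resolve_left
      (hp.1 X hX).ne_empty
    obtain ⟨j, htj, hj, hv⟩ := hall v
    obtain ⟨Z, hZ, hvZ, Z', hZ', hne, hm⟩ := (hredI j (by omega) hj v).1 hv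
    have hpj := (hT.chain j (by omega) hj).1.isParts
    obtain ⟨P, hP, hZP⟩ := hT.refines ht1 htj hj Z hZ
    obtain ⟨Q, hQ, hZQ⟩ := hT.refines ht1 htj hj Z' hZ'
    have hPe : P = {v} := hp.2.2 P hP _ hX v (hZP hvZ) rfl
    subst hPe
    refine ⟨Q, hQ, ?_, hm.mono hZP hZQ⟩
    rintro rfl
    obtain ⟨z, hz⟩ := hpj.1 Z' hZ'
    have : z = v := hZQ hz
    exact hne (hpj.2.2 Z hZ Z' hZ' v hvZ (this ▸ hz))
  have ht2 : 2 ≤ t := by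
    rw [← hcard]
    exact (Set.one_lt_ncard_iff (Set.toFinite _)).2 ⟨S, R, hS, hR, hSR⟩
  have ht : t = 2 := by
    by_contra hne
    obtain ⟨X, hX, Y, hY, hXY, he⟩ := hT.1.2 (t - 1) (by omega) (by omega)
    rw [Nat.sub_add_cancel ht1] at hX hY he
    have hv : (T (t - 1)).verts = mergeParts (T t).verts X Y := by rw [he]; rfl
    obtain ⟨Z, hZ, hZn⟩ := Set.exists_mem_notMem_of_ncard_lt_ncard
      (s := {X, Y}) (t := (T t).verts) (by
        have := Set.ncard_pair hXY
        omega)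
    simp only [Set.mem_insert_iff, Set.mem_singleton_iff, not_or] at hZn
    refine not_deg1_merge hG hp hc.deg1 hfull hX hY hZ hXY hZn.1 hZn.2 ?_
    rw [← hv]
    exact (hT.chain (t - 1) (by omega) (by omega)).1.deg1
  subst ht
  have hn : 2 < Nat.card V := by
    refine lt_of_le_of_ne htn fun e => ?_
    obtain ⟨X, -, -, Y, hY⟩ := hred
    rw [e, hT.1.1] at hY
    exact hY
  obtain ⟨hc3, -, hcard3⟩ := hT.chain 3 (by omega) (by omega)
  have hp3 := hc3.isParts
  have hhom : ∀ X ∈ (T 3).verts, s ∈ X → ∀ Y ∈ (T 3).verts, X ≠ Y → ¬ Mixed G X Y := by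
    intro X hX hsX Y hY hXY hm
    exact hbefore 3 (by omega) (by omega)
      ((hredI 3 (by omega) (by omega) s).2 ⟨X, hX, hsX, Y, hY, hXY, hm⟩)
  -- A larger part containing `s` would be mixed with another one by primality, making `s` red too
  -- early.
  have hs3 : {s} ∈ (T 3).verts := by
    obtain ⟨X, hX, hsX⟩ := hp3.2.1 s
    by_cases hnt : X.Nontrivial
    · exfalso
      have hu : X ≠ Set.univ := by
        rintro rfl
        obtain ⟨Z, hZ, hZn⟩ := Set.exists_mem_notMem_of_ncard_lt_ncard
          (s := {Set.univ}) (t := (T 3).verts) (by rw [Set.ncard_singleton]; omega)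
        obtain ⟨z, hz⟩ := hp3.1 Z hZ
        exact hZn (hp3.2.2 Z hZ _ hX z hz trivial)
      obtain ⟨Y, hY, hXY, hm⟩ := hG.exists_mixed hp3 hnt hu
      exact hhom X hX hsX Y hY hXY hm
    · rwa [← (Set.not_nontrivial_iff.1 hnt).eq_singleton_of_mem hsX]
  have h2 : ((T 3).verts \ {{s}}).ncard = 2 := by
    have := Set.ncard_sdiff_singleton_add_one hs3
    omega
  obtain ⟨U, W, hUW, he⟩ := Set.ncard_eq_two.1 h2
  have hU : U ∈ (T 3).verts \ {{s}} := by rw [he]; exact Or.inl rfl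
  have hW : W ∈ (T 3).verts \ {{s}} := by rw [he]; exact Or.inr rfl
  have hside : ∀ P ∈ (T 3).verts \ {{s}}, ∃ i, P ⊆ side G s i := by
    rintro P ⟨hP, hPs⟩
    have hsP : s ∉ P := fun h => hPs (hp3.2.2 P hP _ hs3 s h rfl)
    have := hhom {s} hs3 rfl P hP (Ne.symm hPs)
    rw [mixed_singleton_iff, not_not] at this
    rcases this with h | h
    · exact ⟨true, h⟩
    · exact ⟨false, fun a ha => ⟨fun e => hsP (e ▸ ha), h a ha⟩⟩
  have hcover : ∀ v, v ≠ s → v ∈ U ∨ v ∈ W := by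
    intro v hv
    obtain ⟨P, hP, hvP⟩ := hp3.2.1 v
    have : P ∈ (T 3).verts \ {{s}} := ⟨hP, fun e => hv (by rwa [Set.mem_singleton_iff.1 e] at hvP)⟩
    rw [he] at this
    rcases this with rfl | rfl
    exacts [Or.inl hvP, Or.inr hvP]
  obtain ⟨i, hi⟩ := hside U hU
  obtain ⟨j, hj⟩ := hside W hW
  have hns : ∀ i, s ∉ side G s i := by
    rintro (_ | _) h
    exacts [h.1 rfl, G.loopless.irrefl s h]
  have hdisj : ∀ v, ¬ (v ∈ side G s true ∧ v ∈ side G s false) := fun v h => h.2.2 h.1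
  -- If both parts were on the same side, the complement of `s` would be a nontrivial proper module.
  have hij : i ≠ j := by
    rintro rfl
    have hall : ∀ v ∈ ({s} : Set V)ᶜ, v ∈ side G s i := fun v hv =>
      (hcover v hv).elim (fun h => hi h) fun h => hj h
    obtain ⟨u, hu⟩ := hp3.1 U hU.1
    obtain ⟨w, hw⟩ := hp3.1 W hW.1
    obtain ⟨v, hv, hvn⟩ := hG.exists_not_homog (N := {s}ᶜ)
      ⟨u, fun e => hns i ((Set.mem_singleton_iff.1 e) ▸ hi hu), w,
        fun e => hns i ((Set.mem_singleton_iff.1 e) ▸ hj hw),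
        fun e => hUW (hp3.2.2 U hU.1 W hW.1 u hu (e ▸ hw))⟩
      (fun e => (e ▸ Set.mem_univ s : s ∈ ({s} : Set V)ᶜ) rfl)
    rw [Set.mem_compl_iff, not_not, Set.mem_singleton_iff] at hv
    subst hv
    refine hvn ?_
    cases i
    · exact Or.inr fun a ha => (hall a ha).2
    · exact Or.inl fun a ha => hall a ha
  refine ⟨_, hc3, hs3, ?_⟩
  have hUe : U = side G s i := by
    refine hi.antisymm fun v hv => (hcover v fun e => hns i (e ▸ hv)).resolve_right fun h => ?_
    have := hj h
    cases i <;> cases j <;> first | exact hij rfl | exact hdisj v ⟨hv, this⟩ | exact hdisj v ⟨this, hv⟩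
  have hWe : W = side G s j := by
    refine hj.antisymm fun v hv => (hcover v fun e => hns j (e ▸ hv)).resolve_left fun h => ?_
    have := hi h
    cases i <;> cases j <;> first | exact hij rfl | exact hdisj v ⟨hv, this⟩ | exact hdisj v ⟨this, hv⟩
  intro k
  rcases (by cases i <;> cases j <;> cases k <;> simp_all : k = i ∨ k = j) with rfl | rfl
  · exact hUe ▸ hU.1
  · exact hWe ▸ hW.1

/-- A chain ending with the partition into `{q}` and two further parts, neither of them split by
`q`, extends to a `1`-sequence in which `q` is last to become incident to a red edge. -/
theorem exists_seq_last_red [Finite V] {G : SimpleGraph V} {q : V} {X Y : Set V}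
    (hc : Chain G {X, Y, {q}}) (hXY : X ≠ Y) (hqX : q ∉ X) (hqY : q ∉ Y)
    (hX : Homog G q X) (hY : Homog G q Y) (hq : ¬ Homog G q (X ∪ Y)) :
    ∃ T, IsDSequence G 1 T ∧ IsLastRedIncident T q := by
  have hp := hc.isParts
  have hXq : X ≠ {q} := fun e => hqX (e ▸ rfl)
  have hYq : Y ≠ {q} := fun e => hqY (e ▸ rfl)
  have hUq : X ∪ Y ≠ {q} := fun e => (e ▸ rfl : q ∈ X ∪ Y).elim hqX hqY
  have hncard : ({X, Y, {q}} : Set (Set V)).ncard = 3 := Set.ncard_eq_three.2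
    ⟨X, Y, {q}, hXY, hXq, hYq, rfl⟩
  obtain ⟨𝒯, h1, h2, h3, h4⟩ := hc.exists_seq
  rw [hncard] at h2 h3 h4
  have hcov : X ∪ Y ∪ {q} = Set.univ := by
    ext v
    simp only [Set.mem_univ, iff_true]
    obtain ⟨P, hP, hv⟩ := hp.2.1 v
    rcases hP with rfl | rfl | hP
    · exact Or.inl (Or.inl hv)
    · exact Or.inl (Or.inr hv)
    · rw [Set.mem_singleton_iff] at hP
      exact Or.inr (hP ▸ hv)
  have e2 : mergeParts {X, Y, {q}} X Y = {X ∪ Y, {q}} := by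
    ext P
    simp only [mergeParts, Set.mem_insert_iff, Set.mem_sdiff, Set.mem_singleton_iff]
    constructor
    · rintro (h | ⟨h | h | h, h'⟩)
      · exact Or.inl h
      · exact (h' (Or.inl h)).elim
      · exact (h' (Or.inr (Or.inl h))).elim
      · exact Or.inr h
    · rintro (h | rfl)
      · exact Or.inl h
      · exact Or.inr ⟨Or.inr (Or.inr rfl), by
          rintro (h | h | h); exacts [hXq h.symm, hYq h.symm, hUq h.symm]⟩
  have e1 : mergeParts {X ∪ Y, {q}} (X ∪ Y) {q} = {Set.univ} := by
    ext P
    simp only [mergeParts, hcov, Set.mem_insert_iff, Set.mem_sdiff, Set.mem_singleton_iff]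
    tauto
  have hd2 : Deg1 G (mergeParts {X, Y, {q}} X Y) := by
    rw [e2]
    rintro P (rfl | rfl) Q (rfl | rfl) R (rfl | rfl) a b _ _ <;>
      first | rfl | exact (a rfl).elim | exact (b rfl).elim
  have hc2 := hc.merge (Or.inl rfl) (Or.inr (Or.inl rfl)) hXY hd2
  rw [e2] at hc2
  have hd1 : Deg1 G (mergeParts {X ∪ Y, {q}} (X ∪ Y) {q}) := by
    rw [e1]
    rintro P rfl Q rfl R rfl a b _ _
    rfl
  have hc1 := hc2.merge (Or.inl rfl) (Or.inr rfl) hUq hd1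
  rw [e1] at hc1
  -- Two final merges are appended. With at most two parts the degree bound is automatic, and with
  -- exactly two the red edge between `{q}` and `X ∪ Y` reaches every vertex.
  set 𝒮 : ℕ → Set (Set V) := fun i =>
    if 3 ≤ i then 𝒯 i else if i = 2 then {X ∪ Y, {q}} else {Set.univ} with h𝒮
  have s1 : 𝒮 1 = {Set.univ} := rfl
  have s2 : 𝒮 2 = {X ∪ Y, {q}} := rfl
  have s3 : ∀ i, 3 ≤ i → 𝒮 i = 𝒯 i := fun i hi => if_pos hi
  have hchain : ∀ i, 1 ≤ i → i ≤ Nat.card V → Chain G (𝒮 i) := by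
    intro i hi hi'
    rcases (by omega : i = 1 ∨ i = 2 ∨ 3 ≤ i) with rfl | rfl | h
    · exact hc1
    · exact hc2
    · rw [s3 i h]; exact (h4 i h hi').1
  have hm : Mixed G {q} (X ∪ Y) := mixed_singleton_iff.2 hq
  refine ⟨fun i => quotTrigraph G (𝒮 i), ⟨⟨?_, ?_⟩, ?_⟩, 2, by omega, by omega, ?_, ?_, ?_⟩
  · change quotTrigraph G (𝒮 (Nat.card V)) = _
    rw [s3 _ h3, h1, ofGraph_eq]
  · intro i hi hi'
    have key : ∃ P ∈ 𝒮 (i + 1), ∃ Q ∈ 𝒮 (i + 1), P ≠ Q ∧ 𝒮 i = mergeParts (𝒮 (i + 1)) P Q := by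
      rcases (by omega : i = 1 ∨ i = 2 ∨ 3 ≤ i) with rfl | rfl | h
      · exact ⟨X ∪ Y, Or.inl rfl, {q}, Or.inr rfl, hUq, by rw [s1, s2, e1]⟩
      · rw [s2, s3 3 le_rfl, h2]
        exact ⟨X, Or.inl rfl, Y, Or.inr (Or.inl rfl), hXY, e2.symm⟩
      · rw [s3 i h, s3 (i + 1) (by omega)]
        exact (h4 i h hi'.le).2.2 hi'
    obtain ⟨P, hP, Q, hQ, hPQ, he⟩ := key
    refine ⟨P, hP, Q, hQ, hPQ, ?_⟩
    change quotTrigraph G (𝒮 i) = (quotTrigraph G (𝒮 (i + 1))).contract P Q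
    rw [contract_eq G (hchain (i + 1) (by omega) (by omega)).isParts hP hQ, he]
  · intro i hi hi'
    exact redDegree_le_one_iff.2 (hchain i hi hi').deg1
  · refine quotTrigraph_redIncident.2 ?_
    rw [s2]
    exact ⟨{q}, Or.inr rfl, rfl, X ∪ Y, Or.inl rfl, hUq.symm, hm⟩
  · intro j hj hj' hr
    obtain ⟨P, hP, hqP, Q, hQ, hPQ, hmPQ⟩ := quotTrigraph_redIncident.1 hr
    rw [s3 j (by omega)] at hP hQ
    obtain ⟨hcj, href, -⟩ := h4 j (by omega) hj'
    -- The earlier partitions refine `{X, Y, {q}}`, so until then `q` is alone in its part and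
    -- splits no part.
    have hsub : P ⊆ {q} := by
      obtain ⟨P', hP', hPP'⟩ := href P hP
      rcases hP' with rfl | rfl | hP'
      · exact (hqX (hPP' hqP)).elim
      · exact (hqY (hPP' hqP)).elim
      · rw [Set.mem_singleton_iff] at hP'
        exact hP' ▸ hPP'
    obtain ⟨Q', hQ', hQQ'⟩ := href Q hQ
    have hmq := hmPQ.mono hsub hQQ'
    rw [mixed_singleton_iff] at hmq
    rcases hQ' with rfl | rfl | hQ'
    · exact hmq hX
    · exact hmq hY
    · rw [Set.mem_singleton_iff] at hQ'
      subst hQ'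
      obtain ⟨x, hx⟩ := hcj.isParts.1 Q hQ
      have : x = q := hQQ' hx
      exact hPQ (hcj.isParts.2.2 P hP Q hQ q hqP (this ▸ hx))
  · intro v
    refine ⟨2, le_rfl, by omega, quotTrigraph_redIncident.2 ?_⟩
    rw [s2]
    rcases (hcov ▸ Set.mem_univ v : v ∈ X ∪ Y ∪ {q}) with h | h
    · exact ⟨_, Or.inl rfl, h, {q}, Or.inr rfl, hUq, hm.symm⟩
    · exact ⟨_, Or.inr rfl, h, _, Or.inl rfl, hUq.symm, hm⟩

end LastRed

/-! ### Prime nodes and indecomposable modules -/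

section Gallai

variable {V : Type*}

/-- `M` splits into two nonempty parts with all edges or no edges between them. -/
def Decomposable (G : SimpleGraph V) (M : Set V) : Prop :=
  ∃ N₁ N₂ : Set V, N₁.Nonempty ∧ N₂.Nonempty ∧ Disjoint N₁ N₂ ∧ N₁ ∪ N₂ = M ∧ ¬ Mixed G N₁ N₂

variable {G : SimpleGraph V} {M N N₁ N₂ : Set V}

theorem Homog.adj_iff {v a b : V} (h : Homog G v N) (ha : a ∈ N) (hb : b ∈ N) :
    G.Adj v a ↔ G.Adj v b := by
  rcases h with h | h
  · exact iff_of_true (h a ha) (h b hb)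
  · exact iff_of_false (h a ha) (h b hb)

theorem homog_of_adj_iff {v : V} (h : ∀ a ∈ N, ∀ b ∈ N, (G.Adj v a ↔ G.Adj v b)) :
    Homog G v N := by
  by_contra hn
  rw [not_homog_iff] at hn
  obtain ⟨⟨a, ha, h1⟩, b, hb, h2⟩ := hn
  exact h2 ((h a ha b hb).1 h1)

theorem isModule_singleton (G : SimpleGraph V) (v : V) : IsModule G {v} :=
  fun _ _ => homog_of_adj_iff fun _ ha _ hb => by
    rw [Set.mem_singleton_iff.1 ha, Set.mem_singleton_iff.1 hb]

theorem isNode_singleton (G : SimpleGraph V) (v : V) : IsNode G {v} := by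
  refine ⟨⟨v, rfl⟩, isModule_singleton G v, fun M' _ => ?_⟩
  by_cases h : v ∈ M'
  · exact Or.inl (Set.singleton_subset_iff.2 h)
  · exact Or.inr (Or.inr (Set.disjoint_singleton_left.2 h))

/-- With `b ∈ N₂ \ N₁`, adjacency is carried from `x, y` to `x, b` by the module `N₂`, to `x', b` by
`N₁`, and to `x', y'` by `N₂` again. -/
theorem not_mixed_sdiff (h1 : IsModule G N₁) (h2 : IsModule G N₂) (h : ¬ N₂ ⊆ N₁) :
    ¬ Mixed G (N₁ \ N₂) N₂ := by
  obtain ⟨b, hb, hbn⟩ := Set.not_subset.1 h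
  rintro ⟨⟨x, hx, y, hy, hxy⟩, x', hx', y', hy', hxy'⟩
  have e1 := Homog.adj_iff (h2 x hx.2) hy hb
  have e2 := Homog.adj_iff (h1 b hbn) hx.1 hx'.1
  have e3 := Homog.adj_iff (h2 x' hx'.2) hb hy'
  exact hxy' (e3.1 (e2.1 (e1.1 hxy).symm).symm)

theorem IsModule.union (h1 : IsModule G N₁) (h2 : IsModule G N₂) (h : ¬ Disjoint N₁ N₂) :
    IsModule G (N₁ ∪ N₂) := by
  obtain ⟨c, hc1, hc2⟩ := Set.not_disjoint_iff.1 h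
  intro v hv
  have a1 : Homog G v N₁ := h1 v fun h => hv (Or.inl h)
  have a2 : Homog G v N₂ := h2 v fun h => hv (Or.inr h)
  refine homog_of_adj_iff ?_
  have : ∀ a ∈ N₁ ∪ N₂, (G.Adj v a ↔ G.Adj v c) := by
    rintro a (ha | ha)
    exacts [a1.adj_iff ha hc1, a2.adj_iff ha hc2]
  exact fun a ha b hb => (this a ha).trans (this b hb).symm

theorem isStrongModule_of_not_decomposable (h : IsModule G M) (hd : ¬ Decomposable G M) :
    IsStrongModule G M := by
  refine ⟨h, fun M' hM' => ?_⟩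
  by_contra hcon
  push Not at hcon
  obtain ⟨h1, h2, h3⟩ := hcon
  refine hd ⟨M \ M', M ∩ M', Set.not_subset.1 h1, Set.not_disjoint_iff_nonempty_inter.1 h3, ?_,
    Set.sdiff_union_inter M M', ?_⟩
  · exact Set.disjoint_left.2 fun x hx hx' => hx.2 hx'.2
  · exact fun hm => not_mixed_sdiff h hM' h2 (hm.mono subset_rfl Set.inter_subset_right)

/-- A maximal nonempty proper submodule of `M`. -/
def IsMaxSub (G : SimpleGraph V) (M P : Set V) : Prop :=
  Maximal (fun K : Set V => K.Nonempty ∧ IsModule G K ∧ K ⊂ M) P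

theorem exists_isMaxSub [Finite V] (hN : N.Nonempty) (h : IsModule G N) (hNM : N ⊂ M) :
    ∃ P, N ⊆ P ∧ IsMaxSub G M P :=
  Set.Finite.exists_le_maximal (s := {K : Set V | K.Nonempty ∧ IsModule G K ∧ K ⊂ M})
    (Set.toFinite _) ⟨hN, h, hNM⟩

/-- The union is a module. If it is proper, maximality makes it equal to both; if it is `M`, two
incomparable modules would decompose `M` into `N₁ \ N₂` and `N₂`. -/
theorem IsMaxSub.eq_of_not_disjoint (hd : ¬ Decomposable G M) (h1 : IsMaxSub G M N₁)
    (h2 : IsMaxSub G M N₂) (h : ¬ Disjoint N₁ N₂) : N₁ = N₂ := by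
  have hU := h1.prop.2.1.union h2.prop.2.1 h
  have hUM : N₁ ∪ N₂ ⊆ M := Set.union_subset h1.prop.2.2.subset h2.prop.2.2.subset
  by_cases hM : N₁ ∪ N₂ = M
  · by_cases h12 : N₁ ⊆ N₂
    · exact h1.eq_of_subset h2.prop h12
    by_cases h21 : N₂ ⊆ N₁
    · exact (h2.eq_of_subset h1.prop h21).symm
    refine (hd ⟨N₁ \ N₂, N₂, Set.not_subset.1 h12, h2.prop.1, Set.disjoint_sdiff_left, ?_,
      not_mixed_sdiff h1.prop.2.1 h2.prop.2.1 h21⟩).elim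
    rw [Set.sdiff_union_self, hM]
  · have hp : (N₁ ∪ N₂).Nonempty ∧ IsModule G (N₁ ∪ N₂) ∧ N₁ ∪ N₂ ⊂ M :=
      ⟨h1.prop.1.mono Set.subset_union_left, hU, hUM.ssubset_of_ne hM⟩
    exact (h1.eq_of_subset hp Set.subset_union_left).trans
      (h2.eq_of_subset hp Set.subset_union_right).symm

/-- A proper submodule of `M` that meets `N` lies in a maximal one, which meets `N` and hence equals
it. Modules not inside `M` are handled by the strength of `M`. -/
theorem IsMaxSub.isNode [Finite V] (hs : IsStrongModule G M) (hd : ¬ Decomposable G M)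
    (h : IsMaxSub G M N) : IsNode G N := by
  refine ⟨h.prop.1, h.prop.2.1, fun M' hM' => ?_⟩
  by_cases hdis : Disjoint N M'
  · exact Or.inr (Or.inr hdis)
  rcases hs.2 M' hM' with h1 | h1 | h1
  · exact Or.inl (h.prop.2.2.subset.trans h1)
  · rcases h1.eq_or_ssubset with rfl | h2
    · exact Or.inl h.prop.2.2.subset
    · obtain ⟨c, hc, hc'⟩ := Set.not_disjoint_iff.1 hdis
      obtain ⟨P, hP, hmax⟩ := exists_isMaxSub ⟨c, hc'⟩ hM' h2
      have := h.eq_of_not_disjoint hd hmax (Set.not_disjoint_iff.2 ⟨c, hc, hP hc'⟩)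
      exact Or.inr (Or.inl (this ▸ hP))
  · exact (hdis (h1.mono_left h.prop.2.2.subset)).elim

theorem mem_childNodes_iff_isMaxSub [Finite V] (hs : IsStrongModule G M)
    (hd : ¬ Decomposable G M) : N ∈ childNodes G M ↔ IsMaxSub G M N := by
  constructor
  · intro h
    have h' : Maximal (fun K : Set V => IsNode G K ∧ K ⊂ M) N := h
    obtain ⟨P, hNP, hP⟩ := exists_isMaxSub h'.prop.1.1 h'.prop.1.2.1 h'.prop.2
    rwa [h'.eq_of_subset ⟨hP.isNode hs hd, hP.prop.2.2⟩ hNP]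
  · intro h
    exact ⟨⟨h.isNode hs hd, h.prop.2.2⟩, fun K hK hNK =>
      h.le_of_ge ⟨hK.1.1, hK.1.2.1, hK.2⟩ hNK⟩

theorem quotientGraph_adj {A B : childNodes G M} :
    (quotientGraph G M).Adj A B ↔ A ≠ B ∧ ∃ a ∈ (A : Set V), ∃ b ∈ (B : Set V), G.Adj a b := by
  rw [quotientGraph, SimpleGraph.fromRel_adj]
  refine and_congr_right fun _ => ⟨?_, Or.inl⟩
  rintro (h | ⟨a, ha, b, hb, h⟩)
  exacts [h, ⟨b, hb, a, ha, h.symm⟩]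

/-- An indecomposable nontrivial module is a prime node. -/
theorem isPrimeNode_of_not_decomposable [Finite V] (h : IsModule G M) (hM : M.Nontrivial)
    (hd : ¬ Decomposable G M) : IsPrimeNode G M := by
  have hs := isStrongModule_of_not_decomposable h hd
  have hmem : ∀ A : childNodes G M, IsMaxSub G M A := fun A =>
    (mem_childNodes_iff_isMaxSub hs hd).1 A.2
  have hdisj : ∀ A B : childNodes G M, A ≠ B → Disjoint (A : Set V) B := by
    intro A B hAB
    by_contra hcon
    exact hAB (Subtype.ext ((hmem A).eq_of_not_disjoint hd (hmem B) hcon))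
  have hcover : ∀ v ∈ M, ∃ A : childNodes G M, v ∈ (A : Set V) := by
    intro v hv
    obtain ⟨w, hw, hne⟩ := hM.exists_ne v
    obtain ⟨P, hP, hmax⟩ := exists_isMaxSub (M := M) (Set.singleton_nonempty v) (isModule_singleton G v)
      ((Set.singleton_subset_iff.2 hv).ssubset_of_ne
        fun e => hne (Set.mem_singleton_iff.1 (e ▸ hw)))
    exact ⟨⟨P, (mem_childNodes_iff_isMaxSub hs hd).2 hmax⟩, hP rfl⟩
  have hnm : ∀ A B : childNodes G M, A ≠ B → ¬ Mixed G (A : Set V) B := by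
    intro A B hAB hm
    have hAB' := hdisj A B hAB
    refine not_mixed_sdiff (hmem A).prop.2.1 (hmem B).prop.2.1 ?_ (by rwa [hAB'.sdiff_eq_left])
    intro hsub
    obtain ⟨b, hb⟩ := (hmem B).prop.1
    exact Set.disjoint_left.1 hAB' (hsub hb) hb
  have hadj : ∀ A B : childNodes G M, A ≠ B → ∀ a ∈ (A : Set V), ∀ b ∈ (B : Set V),
      (G.Adj a b ↔ (quotientGraph G M).Adj A B) := by
    intro A B hAB a ha b hb
    rw [quotientGraph_adj]
    refine ⟨fun hh => ⟨hAB, a, ha, b, hb, hh⟩, fun hh => ?_⟩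
    by_contra hcon
    exact hnm A B hAB ⟨hh.2, a, ha, b, hb, hcon⟩
  obtain ⟨m, hm⟩ := hM.nonempty
  obtain ⟨C, hC⟩ := hcover m hm
  have hdecomp : ¬ Mixed G (C : Set V) (M \ C) → False := fun hh =>
    hd ⟨C, M \ C, (hmem C).prop.1, Set.nonempty_of_ssubset (hmem C).prop.2.2,
      Set.disjoint_sdiff_right, Set.union_sdiff_cancel (hmem C).prop.2.2.subset, hh⟩
  refine ⟨⟨hM.nonempty, hs⟩, hM, ?_, ?_, ?_⟩
  · intro 𝒮 h𝒮
    set U : Set V := {v | ∃ A ∈ 𝒮, v ∈ (A : Set V)} with hU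
    have hUM : U ⊆ M := by
      rintro v ⟨A, -, hv⟩
      exact (hmem A).prop.2.2.subset hv
    have hUmod : IsModule G U := by
      intro v hv
      by_cases hvM : v ∈ M
      · obtain ⟨D, hD⟩ := hcover v hvM
        have hD𝒮 : D ∉ 𝒮 := fun hh => hv ⟨D, hh, hD⟩
        rcases h𝒮 D hD𝒮 with hh | hh
        · left
          rintro a ⟨A, hA, ha⟩
          exact (hadj D A (fun e => hD𝒮 (e ▸ hA)) v hD a ha).2 (hh A hA)
        · right
          rintro a ⟨A, hA, ha⟩
          exact fun hva => hh A hA ((hadj D A (fun e => hD𝒮 (e ▸ hA)) v hD a ha).1 hva)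
      · exact Homog.mono (h v hvM) hUM
    by_cases hUe : U = M
    · right
      ext A
      simp only [Set.mem_univ, iff_true]
      obtain ⟨a, ha⟩ := (hmem A).prop.1
      obtain ⟨B, hB, haB⟩ : a ∈ U := hUe ▸ (hmem A).prop.2.2.subset ha
      by_cases hAB : A = B
      · exact hAB ▸ hB
      · exact (Set.disjoint_left.1 (hdisj A B hAB) ha haB).elim
    · left
      intro A hA B hB
      obtain ⟨a, ha⟩ := (hmem A).prop.1
      obtain ⟨b, hb⟩ := (hmem B).prop.1
      have hUn : U.Nonempty := ⟨a, A, hA, ha⟩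
      -- A module of the quotient lifts to a module `U` of `G`. If `U` is proper it lies in one
      -- maximal submodule, hence in one child.
      obtain ⟨P, hUP, hP⟩ := exists_isMaxSub (M := M) hUn hUmod (hUM.ssubset_of_ne hUe)
      have e1 := (hmem A).eq_of_not_disjoint hd hP (Set.not_disjoint_iff.2 ⟨a, ha, hUP ⟨A, hA, ha⟩⟩)
      have e2 := (hmem B).eq_of_not_disjoint hd hP (Set.not_disjoint_iff.2 ⟨b, hb, hUP ⟨B, hB, hb⟩⟩)
      exact Subtype.ext (e1.trans e2.symm)
  · intro htop
    refine hdecomp ?_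
    rintro ⟨-, a, ha, b, hb, hab⟩
    obtain ⟨B, hB⟩ := hcover b hb.1
    have hCB : C ≠ B := fun e => hb.2 (e ▸ hB)
    refine hab ((hadj C B hCB a ha b hB).2 (by rw [htop]; exact hCB))
  · intro hbot
    refine hdecomp ?_
    rintro ⟨⟨a, ha, b, hb, hab⟩, -⟩
    obtain ⟨B, hB⟩ := hcover b hb.1
    have hCB : C ≠ B := fun e => hb.2 (e ▸ hB)
    have := (hadj C B hCB a ha b hB).1 hab
    rw [hbot] at this
    exact this

/-- Removing a vertex from a prime node does not leave a module. -/
theorem IsPrimeNode.not_isModule_sdiff [Finite V] (h : IsPrimeNode G M) {v : V} (hv : v ∈ M) :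
    ¬ IsModule G (M \ {v}) := by
  intro hN
  obtain ⟨hnode, hnt, hprime, htop, hbot⟩ := h
  have hmem : ∀ A : childNodes G M, Maximal (fun K : Set V => IsNode G K ∧ K ⊂ M) A := fun A => A.2
  have hdisj : ∀ A B : childNodes G M, A ≠ B → Disjoint (A : Set V) B := by
    intro A B hAB
    rcases (hmem A).prop.1.2.2 B (hmem B).prop.1.2.1 with h1 | h1 | h1
    · exact (hAB (Subtype.ext ((hmem A).eq_of_subset (hmem B).prop h1))).elim
    · exact (hAB (Subtype.ext ((hmem B).eq_of_subset (hmem A).prop h1).symm)).elim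
    · exact h1
  obtain ⟨w, hw, hwv⟩ := hnt.exists_ne v
  have hsing : {v} ⊂ M := (Set.singleton_subset_iff.2 hv).ssubset_of_ne
    fun e => hwv (Set.mem_singleton_iff.1 (e ▸ hw))
  obtain ⟨C, hvC, hC⟩ := Set.Finite.exists_le_maximal
    (Set.toFinite {K : Set V | IsNode G K ∧ K ⊂ M}) ⟨isNode_singleton G v, hsing⟩
  have hvC' : v ∈ C := hvC rfl
  -- The child containing `v` is strong and cannot overlap the module `M \ {v}`.
  have hCe : C = {v} := by
    rcases hC.prop.1.2.2 _ hN with h1 | h1 | h1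
    · exact ((h1 hvC').2 rfl).elim
    · refine (hC.prop.2.ne (hC.prop.2.subset.antisymm fun x hx => ?_)).elim
      by_cases hxv : x = v
      · exact hxv ▸ hvC'
      · exact h1 ⟨hx, hxv⟩
    · ext x
      constructor
      · intro hx
        by_contra hxv
        exact Set.disjoint_left.1 h1 hx ⟨hC.prop.2.subset hx, hxv⟩
      · rintro rfl
        exact hvC'
  subst hCe
  let D : childNodes G M := ⟨{v}, hC⟩
  have hsub : ∀ B : childNodes G M, B ≠ D → (B : Set V) ⊆ M \ {v} := fun B hB x hx =>
    ⟨(hmem B).prop.2.subset hx, fun e => Set.disjoint_left.1 (hdisj B D hB) hx e⟩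
  have hDall : (∀ B, B ≠ D → (quotientGraph G M).Adj D B) ∨
      ∀ B, B ≠ D → ¬ (quotientGraph G M).Adj D B := by
    rcases hN v (fun hh => hh.2 rfl) with hh | hh
    · left
      intro B hB
      obtain ⟨b, hb⟩ := (hmem B).prop.1.1
      exact quotientGraph_adj.2 ⟨hB.symm, v, rfl, b, hb, hh b (hsub B hB hb)⟩
    · right
      intro B hB hadj
      obtain ⟨-, a, ha, b, hb, hab⟩ := quotientGraph_adj.1 hadj
      rw [show a = v from ha] at hab
      exact hh b (hsub B hB hb) hab
  have hmod : IsModule (quotientGraph G M) {B | B ≠ D} := by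
    intro A hA
    have : A = D := not_not.1 hA
    subst this
    exact hDall
  -- The other children form a module of the prime quotient, so there is at most one of them, and a
  -- quotient that small is complete or edgeless.
  rcases hprime _ hmod with hss | hu
  · have hcases : ∀ A B : childNodes G M, A ≠ B → A = D ∧ B ≠ D ∨ B = D ∧ A ≠ D := by
      intro A B hAB
      by_cases hA : A = D
      · exact Or.inl ⟨hA, fun e => hAB (hA.trans e.symm)⟩
      by_cases hB : B = D
      · exact Or.inr ⟨hB, hA⟩
      · exact (hAB (hss hA hB)).elim
    rcases hDall with hh | hh
    · refine htop ?_
      ext A B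
      refine ⟨fun e => e.ne, fun hAB => ?_⟩
      rcases hcases A B hAB with ⟨rfl, h2⟩ | ⟨rfl, h2⟩
      exacts [hh B h2, (hh A h2).symm]
    · refine hbot ?_
      ext A B
      refine ⟨fun e => ?_, fun e => e.elim⟩
      rcases hcases A B e.ne with ⟨rfl, h2⟩ | ⟨rfl, h2⟩
      exacts [hh B h2 e, hh A h2 e.symm]
  · exact (hu ▸ Set.mem_univ D : D ∈ {B | B ≠ D}) rfl

theorem IsPrimeNode.not_homog_sdiff [Finite V] (h : IsPrimeNode G M) {v : V} (hv : v ∈ M) :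
    ¬ Homog G v (M \ {v}) := by
  intro hh
  refine h.not_isModule_sdiff hv fun w hw => ?_
  by_cases hwM : w ∈ M
  · by_cases hwv : w = v
    · exact hwv ▸ hh
    · exact (hw ⟨hwM, hwv⟩).elim
  · exact Homog.mono (h.1.2.1 w hwM) Set.sdiff_subset

end Gallai

/-! ### Realisers and the shrinking of good sets -/

section Betweenness

variable {V : Type*} {n : ℕ} {G : SimpleGraph V} {σ τ : V ≃ Fin n} {s : V}

/-- `c` lies strictly between `a` and `b` in the ordering `σ`. -/
def Btw (σ : V ≃ Fin n) (a c b : V) : Prop :=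
  (σ a < σ c ∧ σ c < σ b) ∨ (σ b < σ c ∧ σ c < σ a)

/-- Edges are inversions. Replacing `a` by `b` reverses the order relative to `c` exactly in those
orderings where `c` separates them, so adjacency is kept when this happens in both or in neither. -/
theorem IsRealiser.adj_iff_adj_iff (h : IsRealiser G σ τ) {a b c : V} (ha : c ≠ a) (hb : c ≠ b) :
    (G.Adj c a ↔ G.Adj c b) ↔ (Btw σ a c b ↔ Btw τ a c b) := by
  rw [h c a, h c b]
  unfold Btw
  have h1 := σ.injective.ne ha
  have h2 := σ.injective.ne hb
  have h3 := τ.injective.ne ha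
  have h4 := τ.injective.ne hb
  generalize σ a = a1 at *
  generalize σ b = b1 at *
  generalize σ c = c1 at *
  generalize τ a = a2 at *
  generalize τ b = b2 at *
  generalize τ c = c2 at *
  rcases lt_or_gt_of_ne h1 with h1 | h1 <;> rcases lt_or_gt_of_ne h2 with h2 | h2 <;>
  rcases lt_or_gt_of_ne h3 with h3 | h3 <;> rcases lt_or_gt_of_ne h4 with h4 | h4 <;>
  simp [h1, h2, h3, h4, h1.not_gt, h2.not_gt, h3.not_gt, h4.not_gt]

theorem IsRealiser.homog_of_not_btw (h : IsRealiser G σ τ) {v : V} {N : Set V} (hv : v ∉ N)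
    (h1 : ∀ a ∈ N, ∀ b ∈ N, ¬ Btw σ a v b) (h2 : ∀ a ∈ N, ∀ b ∈ N, ¬ Btw τ a v b) :
    Homog G v N :=
  homog_of_adj_iff fun a ha b hb =>
    (h.adj_iff_adj_iff (ne_of_mem_of_not_mem ha hv).symm (ne_of_mem_of_not_mem hb hv).symm).2
      (iff_of_false (h1 a ha b hb) (h2 a ha b hb))

theorem IsRealiser.btw_iff (h : IsRealiser G σ τ) {v : V} {N : Set V} (hv : v ∉ N)
    (hN : Homog G v N) {a b : V} (ha : a ∈ N) (hb : b ∈ N) : Btw σ a v b ↔ Btw τ a v b :=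
  (h.adj_iff_adj_iff (ne_of_mem_of_not_mem ha hv).symm (ne_of_mem_of_not_mem hb hv).symm).1
    (hN.adj_iff ha hb)

theorem IsEndpoint.not_btw (h : IsEndpoint σ s) (a b : V) : ¬ Btw σ a s b := by
  rintro (⟨h1, h2⟩ | ⟨h1, h2⟩) <;> rcases h with h | h
  exacts [(h a).not_gt h1, (h b).not_gt h2, (h b).not_gt h1, (h a).not_gt h2]

theorem notMem_side (G : SimpleGraph V) (s : V) (i : Bool) : s ∉ side G s i := by
  cases i
  exacts [fun h => h.1 rfl, fun h => G.loopless.irrefl s h]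

theorem mem_side_or (G : SimpleGraph V) {s v : V} (i : Bool) (h : v ≠ s) :
    v ∈ side G s i ∨ v ∈ side G s (!i) := by
  cases i
  · exact (em (G.Adj s v)).symm.imp (fun h' => ⟨h, h'⟩) id
  · exact (em (G.Adj s v)).imp id fun h' => ⟨h, h'⟩

theorem notMem_side_not {v : V} {i : Bool} (h : v ∈ side G s i) : v ∉ side G s (!i) := by
  intro h'
  cases i
  exacts [h.2 h', h'.2 h]

theorem notMem_side_of_not {v : V} {i : Bool} (h : v ∈ side G s (!i)) : v ∉ side G s i :=
  fun h' => notMem_side_not h' h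

theorem homog_side (G : SimpleGraph V) (s : V) (i : Bool) : Homog G s (side G s i) := by
  cases i
  exacts [Or.inr fun a ha => ha.2, Or.inl fun a ha => ha]

theorem not_adj_iff_adj_of_side {a c : V} {i : Bool} (ha : a ∈ side G s i)
    (hc : c ∈ side G s (!i)) : ¬ (G.Adj s a ↔ G.Adj s c) := by
  cases i
  exacts [fun h => ha.2 (h.2 hc), fun h => hc.2 (h.1 ha)]

theorem not_btw_endpoint (hr : IsRealiser G σ τ) (hs : IsEndpoint σ s) {i : Bool} {a b : V}
    (ha : a ∈ side G s i) (hb : b ∈ side G s i) : ¬ Btw τ a s b := fun h =>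
  hs.not_btw a b ((hr.btw_iff (notMem_side G s i) (homog_side G s i) ha hb).2 h)

theorem btw_endpoint (hr : IsRealiser G σ τ) (hs : IsEndpoint σ s) {i : Bool} {a c : V}
    (ha : a ∈ side G s i) (hc : c ∈ side G s (!i)) : Btw τ a s c := by
  by_contra hcon
  refine not_adj_iff_adj_of_side ha hc ((hr.adj_iff_adj_iff ?_ ?_).2
    (iff_of_false (hs.not_btw a c) hcon))
  exacts [(ne_of_mem_of_not_mem ha (notMem_side G s i)).symm,
    (ne_of_mem_of_not_mem hc (notMem_side G s _)).symm]

/-- The sides of an endpoint of `σ` are intervals of `τ`. -/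
theorem not_btw_side (hr : IsRealiser G σ τ) (hs : IsEndpoint σ s) {i : Bool} {a b c : V}
    (ha : a ∈ side G s i) (hb : b ∈ side G s i) (hc : c ∉ side G s i) : ¬ Btw τ a c b := by
  by_cases hcs : c = s
  · exact hcs ▸ not_btw_endpoint hr hs ha hb
  have hc' := (mem_side_or G i hcs).resolve_left hc
  have h1 := btw_endpoint hr hs ha hc'
  have h2 := btw_endpoint hr hs hb hc'
  unfold Btw at *
  grind

/-- An interval of `σ` avoiding `s` that consists of an interval of `τ` on each side of `s`. -/
structure Good (G : SimpleGraph V) (σ τ : V ≃ Fin n) (s : V) (S : Set V) : Prop where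
  notMem : s ∉ S
  nonempty : ∀ i, (S ∩ side G s i).Nonempty
  sigma : ∀ a ∈ S, ∀ b ∈ S, ∀ c, Btw σ a c b → c ∈ S
  tau : ∀ i, ∀ a ∈ S ∩ side G s i, ∀ b ∈ S ∩ side G s i, ∀ c, Btw τ a c b → c ∈ S

variable {S : Set V}

theorem Good.homog (hr : IsRealiser G σ τ) (h : Good G σ τ s S) {v : V} (hv : v ∉ S) (i : Bool) :
    Homog G v (S ∩ side G s i) :=
  hr.homog_of_not_btw (fun h' => hv h'.1) (fun a ha b hb hab => hv (h.sigma a ha.1 b hb.1 v hab))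
    fun a ha b hb hab => hv (h.tau i a ha b hb v hab)

theorem Good.mem_or (h : Good G σ τ s S) {v : V} (hv : v ∈ S) (i : Bool) :
    v ∈ S ∩ side G s i ∨ v ∈ S ∩ side G s (!i) :=
  (mem_side_or G i (ne_of_mem_of_not_mem hv h.notMem)).imp (fun h' => ⟨hv, h'⟩) fun h' => ⟨hv, h'⟩

theorem eq_or_eq_not (i j : Bool) : j = i ∨ j = !i := by
  cases i <;> cases j <;> simp

theorem not_mixed_left {P Q : Set V} (h : ¬ Mixed G P Q) {v : V} (hv : v ∈ P) : Homog G v Q := by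
  rw [← not_not (a := Homog G v Q), ← mixed_singleton_iff]
  exact fun h' => h (h'.mono (Set.singleton_subset_iff.2 hv) subset_rfl)

theorem not_mixed_right {P Q : Set V} (h : ¬ Mixed G P Q) {v : V} (hv : v ∈ Q) : Homog G v P :=
  not_mixed_left (fun h' => h h'.symm) hv

theorem subsingleton_of_homog (hG : IsPrimeGraph G) {N : Set V} {u : V} (hu : u ∉ N)
    (h : ∀ v ∉ N, Homog G v N) : N.Subsingleton :=
  (hG N h).resolve_right fun e => hu (e ▸ Set.mem_univ u)

/-- Removal of a vertex that splits neither side of a good set. -/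
theorem Good.sdiff_singleton (hG : IsPrimeGraph G) (hr : IsRealiser G σ τ) (hs : IsEndpoint σ s)
    (h : Good G σ τ s S) {i : Bool} {v : V} (hv : v ∈ S ∩ side G s i)
    (hne : ((S ∩ side G s i) \ {v}).Nonempty) (h1 : Homog G v ((S ∩ side G s i) \ {v}))
    (h2 : Homog G v (S ∩ side G s (!i))) : Good G σ τ s (S \ {v}) := by
  have hvQ : v ∉ S ∩ side G s (!i) := fun h' => notMem_side_not hv.2 h'.2
  have hvP : v ∉ (S ∩ side G s i) \ {v} := fun h' => h'.2 rfl
  have hQQ : ∀ q ∈ S ∩ side G s (!i), ∀ q' ∈ S ∩ side G s (!i), ¬ Btw σ q v q' := by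
    intro q hq q' hq' hb
    exact not_btw_side hr hs hq.2 hq'.2 (notMem_side_not hv.2) ((hr.btw_iff hvQ h2 hq hq').1 hb)
  obtain ⟨q₀, hq₀⟩ := h.nonempty (!i)
  -- The opposite trace lies entirely on one `σ`-side of `v`. The set `D` consists of `v` and of the
  -- vertices of its own trace beyond `v`; it is shown to be a module, hence `{v}`, so that `v` is
  -- `σ`-extremal in `S`.
  set D : Set V := {x | x ∈ S ∩ side G s i ∧ (x = v ∨ Btw σ x v q₀)} with hD
  have hDP : D ⊆ S ∩ side G s i := fun x hx => hx.1
  have hvD : v ∈ D := ⟨hv, Or.inl rfl⟩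
  have hDsub : D.Subsingleton := by
    refine subsingleton_of_homog hG (fun h' => h.notMem (hDP h').1) fun u hu => ?_
    by_cases huS : u ∈ S
    · rcases h.mem_or huS i with huP | huQ
      · have huv : u ≠ v := fun e => hu (e ▸ hvD)
        have hun : ¬ Btw σ u v q₀ := fun hb => hu ⟨huP, Or.inr hb⟩
        have key : ∀ d ∈ D, d ≠ v → Btw σ d v u ∧ Btw τ d v u := by
          intro d hd hdv
          have hb := hd.2.resolve_left hdv
          have : Btw σ d v u := by
            have e1 := σ.injective.ne huv
            unfold Btw at *
            grind
          exact ⟨this, (hr.btw_iff hvP h1 ⟨hd.1, hdv⟩ ⟨huP, huv⟩).1 this⟩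
        refine hr.homog_of_not_btw hu ?_ ?_
        · intro a ha b hb hab
          by_cases hav : a = v <;> by_cases hbv : b = v
          · subst hav hbv
            unfold Btw at hab; grind
          · have := (key b hb hbv).1
            subst hav
            unfold Btw at *; grind
          · have := (key a ha hav).1
            subst hbv
            unfold Btw at *; grind
          · have := (key a ha hav).1
            have := (key b hb hbv).1
            unfold Btw at *; grind
        · intro a ha b hb hab
          by_cases hav : a = v <;> by_cases hbv : b = v
          · subst hav hbv
            unfold Btw at hab; grind
          · have := (key b hb hbv).2
            subst hav
            unfold Btw at *; grind
          · have := (key a ha hav).2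
            subst hbv
            unfold Btw at *; grind
          · have := (key a ha hav).2
            have := (key b hb hbv).2
            unfold Btw at *; grind
      · refine hr.homog_of_not_btw hu ?_ fun a ha b hb =>
          not_btw_side hr hs (hDP ha).2 (hDP hb).2 (notMem_side_of_not huQ.2)
        have hn := hQQ u huQ q₀ hq₀
        have huv : u ≠ v := fun e => hvQ (e ▸ huQ)
        have e1 := σ.injective.ne huv
        rintro a ⟨-, ha⟩ b ⟨-, hb⟩ hab
        rcases ha with rfl | ha <;> rcases hb with rfl | hb <;> unfold Btw at * <;> grind
    · exact (h.homog hr huS i).mono hDP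
  have hall : ∀ x ∈ S \ {v}, ∀ y ∈ S \ {v}, ¬ Btw σ x v y := by
    have hq₀v : q₀ ≠ v := fun e => hvQ (e ▸ hq₀)
    have key : ∀ x ∈ S \ {v}, ¬ Btw σ x v q₀ := by
      rintro x ⟨hx, hxv⟩ hb
      rcases h.mem_or hx i with hxP | hxQ
      · exact hxv (hDsub ⟨hxP, Or.inr hb⟩ hvD)
      · exact hQQ x hxQ q₀ hq₀ hb
    intro x hx y hy hb
    have a1 := key x hx
    have a2 := key y hy
    have e1 := σ.injective.ne hq₀v
    unfold Btw at *
    grind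
  refine ⟨fun h' => h.notMem h'.1, fun j => ?_, ?_, fun j => ?_⟩
  · rcases eq_or_eq_not i j with rfl | rfl
    · obtain ⟨x, hx, hxv⟩ := hne
      exact ⟨x, ⟨hx.1, hxv⟩, hx.2⟩
    · exact ⟨q₀, ⟨hq₀.1, fun e => hvQ (Set.mem_singleton_iff.1 e ▸ hq₀)⟩, hq₀.2⟩
  · intro a ha b hb c hc
    exact ⟨h.sigma a ha.1 b hb.1 c hc, fun e => hall a ha b hb (Set.mem_singleton_iff.1 e ▸ hc)⟩
  · intro a ha b hb c hc
    refine ⟨h.tau j a ⟨ha.1.1, ha.2⟩ b ⟨hb.1.1, hb.2⟩ c hc, fun e => ?_⟩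
    rw [Set.mem_singleton_iff] at e
    subst e
    rcases eq_or_eq_not i j with rfl | rfl
    · exact hall a ha.1 b hb.1 ((hr.btw_iff hvP h1 ⟨⟨ha.1.1, ha.2⟩, ha.1.2⟩
        ⟨⟨hb.1.1, hb.2⟩, hb.1.2⟩).2 hc)
    · exact not_btw_side hr hs ha.2 hb.2 (notMem_side_not hv.2) hc

/-- A good set with exactly one vertex `q` on one side, together with a chain that merges the
other side `P` into two parts that are not split by `q`. -/
structure Stuck (G : SimpleGraph V) (σ τ : V ≃ Fin n) (s : V) (i : Bool) (q : V) (P : Set V) :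
    Prop where
  subset : P ⊆ side G s i
  mem : q ∈ side G s (!i)
  good : Good G σ τ s (insert q P)
  nontrivial : P.Nontrivial
  chain : ∃ 𝒬 X Y, Chain G 𝒬 ∧ X ∈ 𝒬 ∧ Y ∈ 𝒬 ∧ P ⊆ X ∪ Y ∧ q ∉ X ∧ q ∉ Y ∧
    Homog G q (X ∩ P) ∧ Homog G q (Y ∩ P)

section Stuck

variable {i : Bool} {q : V} {P : Set V}

theorem Stuck.inter_side (h : Stuck G σ τ s i q P) : insert q P ∩ side G s i = P := by
  ext x
  constructor
  · rintro ⟨rfl | hx, hxi⟩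
    · exact (notMem_side_of_not h.mem hxi).elim
    · exact hx
  · exact fun hx => ⟨Or.inr hx, h.subset hx⟩

theorem Stuck.notMem (h : Stuck G σ τ s i q P) : q ∉ P :=
  fun hq => notMem_side_of_not h.mem (h.subset hq)

theorem Stuck.homog (hr : IsRealiser G σ τ) (h : Stuck G σ τ s i q P) {v : V} (hv : v ∉ P)
    (hvq : v ≠ q) : Homog G v P := by
  have := h.good.homog hr (v := v) (by rintro (e | e); exacts [hvq e, hv e]) i
  rwa [h.inter_side] at this

/-- Only `q` can split `P` from outside, so a nontrivial module of `G[P]` not split by `q` would be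
a module of `G`. -/
theorem Stuck.not_homog_of_subset (hG : IsPrimeGraph G) (hr : IsRealiser G σ τ)
    (h : Stuck G σ τ s i q P) {N : Set V} (hN : N ⊆ P) (hnt : N.Nontrivial)
    (hmod : ∀ v ∈ P \ N, Homog G v N) : ¬ Homog G q N := by
  intro hq
  refine Set.not_subsingleton_iff.2 hnt
    (subsingleton_of_homog hG (fun h' => h.notMem (hN h')) fun v hv => ?_)
  by_cases hvq : v = q
  · exact hvq ▸ hq
  by_cases hvP : v ∈ P
  · exact hmod v ⟨hvP, hv⟩
  · exact (h.homog hr hvP hvq).mono hN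

theorem Stuck.not_homog (hG : IsPrimeGraph G) (hr : IsRealiser G σ τ)
    (h : Stuck G σ τ s i q P) : ¬ Homog G q P :=
  h.not_homog_of_subset hG hr subset_rfl h.nontrivial fun _ hv => (hv.2 hv.1).elim

/-- The side containing `P` is an interval of `τ` avoiding `q`, so `q` can separate vertices of `P`
only in `σ`. -/
theorem Stuck.exists_btw (hr : IsRealiser G σ τ) (hs : IsEndpoint σ s)
    (h : Stuck G σ τ s i q P) {N : Set V} (hN : N ⊆ P) (hq : ¬ Homog G q N) :
    ∃ a ∈ N, ∃ b ∈ N, Btw σ a q b := by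
  by_contra hcon
  push Not at hcon
  exact hq (hr.homog_of_not_btw (fun h' => h.notMem (hN h')) hcon fun a ha b hb =>
    not_btw_side hr hs (h.subset (hN ha)) (h.subset (hN hb)) (notMem_side_of_not h.mem))

/-- Since `q` is `σ`-between two vertices of `P`, a `σ`-extremal vertex of `P` is also extremal once
`q` is added. Homogeneity transfers this to `τ`. -/
theorem Stuck.sdiff_singleton (hG : IsPrimeGraph G) (hr : IsRealiser G σ τ)
    (hs : IsEndpoint σ s) (h : Stuck G σ τ s i q P) {v : V} (hv : v ∈ P)
    (h1 : Homog G v (P \ {v})) (h2 : ∀ a ∈ P \ {v}, ∀ b ∈ P \ {v}, ¬ Btw σ a v b)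
    (hnt : (P \ {v}).Nontrivial) : Stuck G σ τ s i q (P \ {v}) := by
  have hqv : q ≠ v := fun e => h.notMem (e ▸ hv)
  obtain ⟨p, hp, p', hp', hpq⟩ := h.exists_btw hr hs subset_rfl (h.not_homog hG hr)
  have hq : ∀ b ∈ P \ {v}, ¬ Btw σ q v b := by
    intro b hb hqb
    by_cases e1 : p = v
    · by_cases e2 : p' = v
      · subst e1; subst e2
        unfold Btw at hpq; grind
      · have := h2 p' ⟨hp', e2⟩ b hb
        subst e1
        unfold Btw at *; grind
    · by_cases e2 : p' = v
      · have := h2 p ⟨hp, e1⟩ b hb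
        subst e2
        unfold Btw at *; grind
      · have a1 := h2 p ⟨hp, e1⟩ b hb
        have a2 := h2 p' ⟨hp', e2⟩ b hb
        unfold Btw at *; grind
  have hall : ∀ a ∈ insert q (P \ {v}), ∀ b ∈ insert q (P \ {v}), ¬ Btw σ a v b := by
    rintro a (rfl | ha) b (rfl | hb) hab
    · unfold Btw at hab; grind
    · exact hq b hb hab
    · exact hq a ha hab.symm
    · exact h2 a ha b hb hab
  have hins : insert q (P \ {v}) ⊆ insert q P := Set.insert_subset_insert Set.sdiff_subset
  have hmem : ∀ c ∈ insert q P, c ≠ v → c ∈ insert q (P \ {v}) := by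
    rintro c (rfl | hc) hcv
    exacts [Or.inl rfl, Or.inr ⟨hc, hcv⟩]
  refine ⟨Set.sdiff_subset.trans h.subset, h.mem, ⟨fun h' => h.good.notMem (hins h'), ?_, ?_, ?_⟩,
    hnt, ?_⟩
  · intro j
    rcases eq_or_eq_not i j with rfl | rfl
    · obtain ⟨x, hx⟩ := hnt.nonempty
      exact ⟨x, Or.inr hx, h.subset hx.1⟩
    · exact ⟨q, Or.inl rfl, h.mem⟩
  · intro a ha b hb c hc
    exact hmem c (h.good.sigma a (hins ha) b (hins hb) c hc) fun e => hall a ha b hb (e ▸ hc)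
  · intro j a ha b hb c hc
    refine hmem c (h.good.tau j a ⟨hins ha.1, ha.2⟩ b ⟨hins hb.1, hb.2⟩ c hc) ?_
    rintro rfl
    rcases eq_or_eq_not i j with rfl | rfl
    · have key : ∀ x ∈ insert q (P \ {c}) ∩ side G s j, x ∈ P \ {c} := by
        rintro x ⟨rfl | hx, hxj⟩
        exacts [(notMem_side_of_not h.mem hxj).elim, hx]
      exact h2 a (key a ha) b (key b hb)
        ((hr.btw_iff (fun h' => h'.2 rfl) h1 (key a ha) (key b hb)).2 hc)
    · exact not_btw_side hr hs ha.2 hb.2 (notMem_side_not (h.subset hv)) hc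
  · obtain ⟨𝒬, X, Y, c1, c2, c3, c4, c5, c6, c7, c8⟩ := h.chain
    exact ⟨𝒬, X, Y, c1, c2, c3, Set.sdiff_subset.trans c4, c5, c6,
      c7.mono (Set.inter_subset_inter_right _ Set.sdiff_subset),
      c8.mono (Set.inter_subset_inter_right _ Set.sdiff_subset)⟩

theorem Stuck.exists_sdiff_singleton [Finite V] (hG : IsPrimeGraph G) (hr : IsRealiser G σ τ)
    (hs : IsEndpoint σ s) (h : Stuck G σ τ s i q P) (hd : Decomposable G P)
    (h3 : 3 ≤ P.ncard) : ∃ v ∈ P, Stuck G σ τ s i q (P \ {v}) := by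
  obtain ⟨N₁, N₂, hN₁, hN₂, hdis, hU, hnm⟩ := hd
  obtain ⟨f, hf, hfmin⟩ := Set.exists_min_image N₁ σ (Set.toFinite _) hN₁
  obtain ⟨h₀, hh, hhmin⟩ := Set.exists_min_image N₂ σ (Set.toFinite _) hN₂
  wlog hfh : σ f < σ h₀ generalizing N₁ N₂ f h₀
  · have hne : f ≠ h₀ := fun e => Set.disjoint_left.1 hdis hf (e ▸ hh)
    exact this N₂ N₁ hN₂ hN₁ hdis.symm (by rw [Set.union_comm, hU]) (fun h' => hnm h'.symm) h₀ hh
      hhmin f hf hfmin ((not_lt.1 hfh).lt_of_ne (σ.injective.ne hne.symm))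
  have hN₁P : N₁ ⊆ P := hU ▸ Set.subset_union_left
  have hN₂P : N₂ ⊆ P := hU ▸ Set.subset_union_right
  have hcases : ∀ x ∈ P, x ∈ N₁ ∨ x ∈ N₂ := fun x hx => by rwa [← hU] at hx
  -- `P` is cut at the first vertex `h₀` of the part that starts later. The initial segment `D` lies
  -- in `N₁`, and neither `D` nor `P \ D` is split by a vertex of `P`.
  set D : Set V := {x | x ∈ P ∧ σ x < σ h₀} with hD
  have hDN : D ⊆ N₁ := fun x hx =>
    (hcases x hx.1).resolve_right fun h' => (hhmin x h').not_gt hx.2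
  have hhN₁ : h₀ ∉ N₁ := fun h' => Set.disjoint_left.1 hdis h' hh
  have hτ : ∀ d ∈ D, ∀ e ∈ N₁, e ∉ D → Btw τ d h₀ e := by
    intro d hd e he heD
    refine (hr.btw_iff hhN₁ (not_mixed_right hnm hh) (hDN hd) he).1 (Or.inl ⟨hd.2, ?_⟩)
    exact (not_lt.1 fun h' => heD ⟨hN₁P he, h'⟩).lt_of_ne
      (σ.injective.ne fun e' => hhN₁ (e' ▸ he))
  have hA : ∀ x ∈ P \ D, Homog G x D := by
    rintro x ⟨hx, hxD⟩
    have hσx : σ h₀ ≤ σ x := not_lt.1 fun h' => hxD ⟨hx, h'⟩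
    rcases hcases x hx with hx1 | hx2
    · refine hr.homog_of_not_btw hxD ?_ ?_
      · rintro a ha b hb (hab | hab)
        exacts [(hσx.trans hab.2.le).not_gt hb.2, (hσx.trans hab.2.le).not_gt ha.2]
      · intro a ha b hb hab
        have e1 := hτ a ha x hx1 hxD
        have e2 := hτ b hb x hx1 hxD
        unfold Btw at *; grind
    · exact (not_mixed_right hnm hx2).mono hDN
  have hB : ∀ d ∈ D, Homog G d (P \ D) := by
    intro d hd
    have hne : ∀ e ∈ P \ D, d ≠ e := fun e he h' => he.2 (h' ▸ hd)
    have hge : ∀ e ∈ P \ D, σ h₀ ≤ σ e := fun e he => not_lt.1 fun h' => he.2 ⟨he.1, h'⟩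
    have hdN₂ : d ∉ N₂ := fun h' => Set.disjoint_left.1 hdis (hDN hd) h'
    have hσ : ∀ e ∈ P \ D, ∀ e' ∈ P \ D, ¬ Btw σ e d e' := by
      rintro e he e' he' (hab | hab)
      exacts [(hab.1.trans hd.2).not_ge (hge e he), (hab.1.trans hd.2).not_ge (hge e' he')]
    have hmix : ∀ e ∈ P \ D, e ∈ N₁ → ∀ e' ∈ P \ D, e' ∈ N₂ → ¬ Btw τ e d e' := by
      intro e he he1 e' he' he2 hb
      have e1 := hτ d hd e he1 he.2
      by_cases heq : e' = h₀
      · subst heq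
        unfold Btw at *; grind
      · refine hσ h₀ ⟨hN₂P hh, fun h' => lt_irrefl _ h'.2⟩ e' he'
          ((hr.btw_iff hdN₂ (not_mixed_left hnm (hDN hd)) hh he2).2 ?_)
        unfold Btw at *; grind
    refine homog_of_adj_iff fun e he e' he' => ?_
    by_cases hboth : e ∈ N₂ ∧ e' ∈ N₂
    · exact (not_mixed_left hnm (hDN hd)).adj_iff hboth.1 hboth.2
    rw [hr.adj_iff_adj_iff (hne e he) (hne e' he')]
    refine iff_of_false (hσ e he e' he') ?_
    rcases hcases e he.1 with a1 | a1 <;> rcases hcases e' he'.1 with a2 | a2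
    · intro hb
      have e1 := hτ d hd e a1 he.2
      have e2 := hτ d hd e' a2 he'.2
      unfold Btw at *; grind
    · exact hmix e he a1 e' he' a2
    · exact fun hb => hmix e' he' a2 e he a1 hb.symm
    · exact (hboth ⟨a1, a2⟩).elim
  have hfin : ∀ v ∈ P, Homog G v (P \ {v}) → (∀ a ∈ P \ {v}, ∀ b ∈ P \ {v}, ¬ Btw σ a v b) →
      ∃ v ∈ P, Stuck G σ τ s i q (P \ {v}) := by
    intro v hv h1 h2
    refine ⟨v, hv, h.sdiff_singleton hG hr hs hv h1 h2 ?_⟩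
    have := Set.ncard_sdiff_singleton_add_one hv
    exact Set.one_lt_ncard_iff_nontrivial.1 (by omega)
  -- Having a single place in `σ`, `q` splits at most one of `D` and `P \ D`. The unsplit one is a
  -- module of `G`, so it is `{f}` or `{h₀}`, the first or the last vertex of `P`.
  by_cases hqD : Homog G q D
  · have hDs : D.Subsingleton := by
      by_contra hcon
      exact h.not_homog_of_subset hG hr (fun x hx => hx.1) (Set.not_subsingleton_iff.1 hcon) hA hqD
    have hfD : f ∈ D := ⟨hN₁P hf, hfh⟩
    have hDe : D = {f} := hDs.eq_singleton_of_mem hfD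
    have hge : ∀ e ∈ P \ {f}, σ h₀ ≤ σ e := fun e he =>
      not_lt.1 fun h' => he.2 (hDe ▸ (⟨he.1, h'⟩ : e ∈ D))
    refine hfin f (hN₁P hf) (hDe ▸ hB f hfD) ?_
    rintro a ha b hb (hab | hab)
    exacts [(hab.1.trans hfh).not_ge (hge a ha), (hab.1.trans hfh).not_ge (hge b hb)]
  · have hqE : Homog G q (P \ D) := by
      by_contra hcon
      obtain ⟨a, ha, b, hb, hab⟩ := h.exists_btw hr hs (fun x hx => hx.1) hqD
      obtain ⟨c, hc, d, hd, hcd⟩ := h.exists_btw hr hs Set.sdiff_subset hcon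
      have e1 : σ h₀ ≤ σ c := not_lt.1 fun h' => hc.2 ⟨hc.1, h'⟩
      have e2 : σ h₀ ≤ σ d := not_lt.1 fun h' => hd.2 ⟨hd.1, h'⟩
      have e3 := ha.2
      have e4 := hb.2
      unfold Btw at *; grind
    have hhE : h₀ ∈ P \ D := ⟨hN₂P hh, fun h' => lt_irrefl _ h'.2⟩
    have hEs : (P \ D).Subsingleton := by
      by_contra hcon
      refine h.not_homog_of_subset hG hr Set.sdiff_subset (Set.not_subsingleton_iff.1 hcon)
        (fun v hv => hB v ?_) hqE
      by_contra hvD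
      exact hv.2 ⟨hv.1, hvD⟩
    have hEe : P \ {h₀} = D := by
      ext x
      constructor
      · rintro ⟨hx, hxh⟩
        by_contra hxD
        exact hxh (hEs ⟨hx, hxD⟩ hhE)
      · exact fun hx => ⟨hx.1, fun e => hhE.2 (Set.mem_singleton_iff.1 e ▸ hx)⟩
    refine hfin h₀ hhE.1 (hEe ▸ hA h₀ hhE) ?_
    rw [hEe]
    rintro a ha b hb (hab | hab)
    exacts [hab.2.not_gt hb.2, hab.2.not_gt ha.2]

end Stuck

theorem Mixed.three_le_ncard [Finite V] {A B : Set V} (h : Mixed G A B) (hd : Disjoint A B) :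
    3 ≤ (A ∪ B).ncard := by
  rw [Set.ncard_union_eq hd]
  obtain ⟨⟨a, ha, b, hb, h1⟩, a', ha', b', hb', h2⟩ := h
  have hA : 0 < A.ncard := (Set.ncard_pos).2 ⟨a, ha⟩
  have hB : 0 < B.ncard := (Set.ncard_pos).2 ⟨b, hb⟩
  by_cases haa : a = a'
  · have : 1 < B.ncard := Set.one_lt_ncard_iff_nontrivial.2
      ⟨b, hb, b', hb', fun e => h2 (haa ▸ e ▸ h1)⟩
    omega
  · have : 1 < A.ncard := Set.one_lt_ncard_iff_nontrivial.2 ⟨a, ha, a', ha', haa⟩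
    omega

/-- A good set on at least three vertices is stuck or loses one vertex. -/
theorem Good.stuck_or_sdiff [Finite V] (hG : IsPrimeGraph G) (hr : IsRealiser G σ τ)
    (hs : IsEndpoint σ s) {𝒬 : Set (Set V)} (hc : Chain G 𝒬) (hside : ∀ i, side G s i ∈ 𝒬)
    (h : Good G σ τ s S) (h3 : 3 ≤ S.ncard) :
    (∃ i q P, S = insert q P ∧ Stuck G σ τ s i q P) ∨
      ∃ v ∈ S, Good G σ τ s (S \ {v}) ∧ 3 ≤ (S \ {v}).ncard := by
  have hSu : ∀ i, S = S ∩ side G s i ∪ S ∩ side G s (!i) := by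
    intro i
    ext x
    exact ⟨fun hx => h.mem_or hx i, fun hx => hx.elim And.left And.left⟩
  -- This is the first merge after which each trace of `S` lies in one part; three vertices cannot
  -- lie in two singletons, so it does not hold at the start. The merge completes the trace on side
  -- `i`, while the other trace is already inside a part `Z`.
  obtain ⟨𝒜, X, Y, hX, hY, hXY, hcA, hφ, hφ', hcM, href⟩ := hc.exists_step
    (fun 𝒜 => ¬ ∀ i, ∃ Z ∈ 𝒜, S ∩ side G s i ⊆ Z) (by
      intro hcon
      obtain ⟨_, ⟨a, rfl⟩, ha⟩ := hcon true
      obtain ⟨_, ⟨b, rfl⟩, hb⟩ := hcon false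
      have h1 : S ⊆ {a} ∪ {b} := by
        rw [hSu true]
        exact Set.union_subset_union ha hb
      have h2 := Set.ncard_le_ncard h1
      have h3 := Set.ncard_union_le ({a} : Set V) {b}
      rw [Set.ncard_singleton, Set.ncard_singleton] at h3
      omega)
    (by
      rw [not_not]
      exact fun i => ⟨_, hside i, Set.inter_subset_right⟩)
  rw [not_not] at hφ'
  push Not at hφ
  obtain ⟨i, hi⟩ := hφ
  have hpQ := hc.isParts
  have hpA := hcA.isParts
  have hPXY : S ∩ side G s i ⊆ X ∪ Y := by
    obtain ⟨Z, hZ, hPZ⟩ := hφ' i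
    rcases hZ with rfl | hZ
    · exact hPZ
    · exact (hi Z hZ.1 hPZ).elim
  have hXYi : X ∪ Y ⊆ side G s i := by
    obtain ⟨R, hR, hRs⟩ := href (X ∪ Y) (Or.inl rfl)
    obtain ⟨p, hp⟩ := h.nonempty i
    rwa [hpQ.2.2 R hR _ (hside i) p (hRs (hPXY hp)) hp.2] at hRs
  obtain ⟨Z, hZ, hQZ⟩ := hφ' (!i)
  obtain ⟨q₀, hq₀⟩ := h.nonempty (!i)
  have hq₀n : q₀ ∉ X ∪ Y := fun h' => notMem_side_of_not hq₀.2 (hXYi h')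
  have hZA : Z ∈ 𝒜 := by
    rcases hZ with rfl | hZ
    · exact (hq₀n (hQZ hq₀)).elim
    · exact hZ.1
  have hZX : Z ≠ X := fun e => hq₀n (Or.inl (e ▸ hQZ hq₀))
  have hZY : Z ≠ Y := fun e => hq₀n (Or.inr (e ▸ hQZ hq₀))
  by_cases hb : ¬ Mixed G (X ∩ (S ∩ side G s i)) (S ∩ side G s (!i)) ∧
      ¬ Mixed G (Y ∩ (S ∩ side G s i)) (S ∩ side G s (!i))
  · left
    -- Neither the vertices of `S` on side `i` nor those outside `S` split this trace, so it is a
    -- module.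
    have hQs : (S ∩ side G s (!i)).Subsingleton := by
      refine subsingleton_of_homog hG (fun h' => h.notMem h'.1) fun v hv => ?_
      by_cases hvS : v ∈ S
      · have hvP := (h.mem_or hvS i).resolve_right hv
        rcases hPXY hvP with h' | h'
        exacts [not_mixed_left hb.1 ⟨h', hvP⟩, not_mixed_left hb.2 ⟨h', hvP⟩]
      · exact h.homog hr hvS _
    have hQe := hQs.eq_singleton_of_mem hq₀
    have hSe : S = insert q₀ (S ∩ side G s i) := by
      rw [Set.insert_eq, ← hQe, Set.union_comm]
      exact hSu i
    refine ⟨i, q₀, S ∩ side G s i, hSe, Set.inter_subset_right, hq₀.2, hSe ▸ h, ?_, 𝒜, X, Y, hcA,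
      hX, hY, hPXY, fun h' => hq₀n (Or.inl h'), fun h' => hq₀n (Or.inr h'),
      not_mixed_right hb.1 hq₀, not_mixed_right hb.2 hq₀⟩
    have h4 := Set.ncard_insert_of_notMem (s := S ∩ side G s i) (a := q₀)
      fun h' => notMem_side_of_not hq₀.2 h'.2
    rw [← hSe] at h4
    exact Set.one_lt_ncard_iff_nontrivial.1 (by omega)
  · right
    wlog hm : Mixed G (X ∩ (S ∩ side G s i)) (S ∩ side G s (!i)) generalizing X Y
    · have hm' : Mixed G (Y ∩ (S ∩ side G s i)) (S ∩ side G s (!i)) := by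
        by_contra h'
        exact hb ⟨hm, h'⟩
      have hcomm : mergeParts 𝒜 Y X = mergeParts 𝒜 X Y := by
        unfold mergeParts
        rw [Set.union_comm, Set.insert_comm]
      rw [← hcomm] at hcM href hφ' hZ
      exact this Y X hY hX hXY.symm hφ' hcM href (by rwa [Set.union_comm])
        (by rwa [Set.union_comm]) hZ (by rwa [Set.union_comm]) hZY hZX
        (fun h' => h'.1 hm') hm'
    -- This red edge uses up the degree of both `X` and `Z`. Hence `Y` is mixed with neither, and
    -- its trace on `S` is a module, so a single vertex.
    have hXZ : Mixed G X Z := hm.mono Set.inter_subset_left hQZ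
    have hnXY : ¬ Mixed G X Y := fun h' => hZY (hcA.deg1 X hX Z hZA Y hY hZX.symm hXY hXZ h')
    have hnYZ : ¬ Mixed G Y Z := fun h' =>
      hXY (hcA.deg1 Z hZA X hX Y hY hZX hZY hXZ.symm h'.symm)
    have hYn : (Y ∩ (S ∩ side G s i)).Nonempty := by
      obtain ⟨p, hp, hpX⟩ := Set.not_subset.1 (hi X hX)
      exact ⟨p, (hPXY hp).resolve_left hpX, hp⟩
    have hXn : (X ∩ (S ∩ side G s i)).Nonempty := by
      obtain ⟨p, hp, hpX⟩ := Set.not_subset.1 (hi Y hY)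
      exact ⟨p, (hPXY hp).resolve_right hpX, hp⟩
    have hdXY : ∀ v ∈ X, v ∉ Y := fun v h1 h2 => hXY (hpA.2.2 X hX Y hY v h1 h2)
    obtain ⟨v, hv⟩ := hYn
    have hYe : Y ∩ (S ∩ side G s i) = {v} := by
      refine Set.Subsingleton.eq_singleton_of_mem ?_ hv
      refine subsingleton_of_homog hG (fun h' => h.notMem h'.2.1) fun u hu => ?_
      by_cases huS : u ∈ S
      · rcases h.mem_or huS i with huP | huQ
        · have huX := (hPXY huP).resolve_right fun h' => hu ⟨h', huP⟩
          exact (not_mixed_left hnXY huX).mono Set.inter_subset_left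
        · exact (not_mixed_right hnYZ (hQZ huQ)).mono Set.inter_subset_left
      · exact (h.homog hr huS i).mono Set.inter_subset_right
    have hPv : (S ∩ side G s i) \ {v} ⊆ X := fun x hx =>
      (hPXY hx.1).resolve_right fun h' => hx.2 (hYe ▸ (⟨h', hx.1⟩ : x ∈ Y ∩ (S ∩ side G s i)))
    have hXv : X ∩ (S ∩ side G s i) ⊆ (S ∩ side G s i) \ {v} := fun x hx =>
      ⟨hx.2, fun e => hdXY x hx.1 (Set.mem_singleton_iff.1 e ▸ hv.1)⟩
    refine ⟨v, hv.2.1, h.sdiff_singleton hG hr hs hv.2 (hXn.mono hXv)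
      ((not_mixed_right hnXY hv.1).mono hPv) ((not_mixed_left hnYZ hv.1).mono hQZ), ?_⟩
    -- The mixed pair survives the removal of `v`, and disjoint mixed sets have at least three
    -- vertices in total.
    refine (hm.three_le_ncard ?_).trans (Set.ncard_le_ncard ?_)
    · exact Set.disjoint_left.2 fun x hx hx' => notMem_side_not hx.2.2 hx'.2
    · rintro x (hx | hx)
      · exact ⟨hx.2.1, (hXv hx).2⟩
      · exact ⟨hx.1, fun e => notMem_side_not hv.2.2 (Set.mem_singleton_iff.1 e ▸ hx.2)⟩

/-- Good sets obtained from `S₀` by adding one vertex at a time, all of them good. -/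
inductive Grow (G : SimpleGraph V) (σ τ : V ≃ Fin n) (s : V) (S₀ : Set V) : Set V → Prop
  | refl : Grow G σ τ s S₀ S₀
  | insert {S : Set V} {v : V} : Grow G σ τ s S₀ S → v ∉ S → Good G σ τ s S →
      Good G σ τ s (insert v S) → Grow G σ τ s S₀ (insert v S)

theorem Grow.trans {S₁ S₂ S₃ : Set V} (h1 : Grow G σ τ s S₁ S₂) (h2 : Grow G σ τ s S₂ S₃) :
    Grow G σ τ s S₁ S₃ := by
  induction h2 with
  | refl => exact h1
  | insert _ hv hg hg' ih => exact ih.insert hv hg hg'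

theorem Good.exists_stuck [Finite V] (hG : IsPrimeGraph G) (hr : IsRealiser G σ τ)
    (hs : IsEndpoint σ s) {𝒬 : Set (Set V)} (hc : Chain G 𝒬) (hside : ∀ i, side G s i ∈ 𝒬)
    (h : Good G σ τ s S) (h3 : 3 ≤ S.ncard) :
    ∃ i q P, Stuck G σ τ s i q P ∧ Grow G σ τ s (insert q P) S := by
  induction hn : S.ncard generalizing S with
  | zero => omega
  | succ m ih =>
    rcases h.stuck_or_sdiff hG hr hs hc hside h3 with ⟨i, q, P, rfl, hst⟩ | ⟨v, hv, hg, h3'⟩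
    · exact ⟨i, q, P, hst, Grow.refl⟩
    · have hcard := Set.ncard_sdiff_singleton_add_one hv
      obtain ⟨i, q, P, hst, hgr⟩ := ih hg h3' (by omega)
      refine ⟨i, q, P, hst, ?_⟩
      have hins : insert v (S \ {v}) = S := Set.insert_sdiff_self_of_mem hv
      have := hgr.insert (fun h' => h'.2 rfl) hg (by rwa [hins])
      rwa [hins] at this

theorem Stuck.exists_reduced [Finite V] (hG : IsPrimeGraph G) (hr : IsRealiser G σ τ)
    (hs : IsEndpoint σ s) {i : Bool} {q : V} {P : Set V} (h : Stuck G σ τ s i q P) :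
    ∃ M, Stuck G σ τ s i q M ∧ Grow G σ τ s (insert q M) (insert q P) ∧
      (M.ncard = 2 ∨ ¬ Decomposable G M) := by
  induction hn : P.ncard generalizing P with
  | zero =>
    have := Set.one_lt_ncard_iff_nontrivial.2 h.nontrivial
    omega
  | succ m ih =>
    have h1 := Set.one_lt_ncard_iff_nontrivial.2 h.nontrivial
    by_cases hd : Decomposable G P ∧ P.ncard ≠ 2
    · obtain ⟨v, hv, hst⟩ := h.exists_sdiff_singleton hG hr hs hd.1 (by omega)
      have hcard := Set.ncard_sdiff_singleton_add_one hv
      obtain ⟨M, hM, hgr, hfin⟩ := ih hst (by omega)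
      refine ⟨M, hM, ?_, hfin⟩
      have hins : insert v (insert q (P \ {v})) = insert q P := by
        rw [Set.insert_comm, Set.insert_sdiff_self_of_mem hv]
      have hvn : v ∉ insert q (P \ {v}) := by
        rintro (e | e)
        exacts [h.notMem (e ▸ hv), e.2 rfl]
      have := hgr.insert hvn hst.good (by rw [hins]; exact h.good)
      rwa [hins] at this
    · exact ⟨P, h, Grow.refl, by tauto⟩

end Betweenness

/-! ### Uniqueness of the prime node, the ordering and the restricted sequence -/

section Main

variable {V : Type*} {n : ℕ} {G : SimpleGraph V} {σ τ : V ≃ Fin n} {s : V}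

theorem isModule_induce {U M : Set V} (h : ∀ v ∈ U, v ∉ M → Homog G v (M ∩ U)) :
    IsModule (G.induce U) (Subtype.val ⁻¹' M) := fun v hv =>
  (h v.1 v.2 hv).imp (fun h' a ha => h' a.1 ⟨ha, a.2⟩) fun h' a ha => h' a.1 ⟨ha, a.2⟩

theorem homog_image_val {U : Set V} {X : Set U} {v : U} (h : Homog (G.induce U) v X) :
    Homog G v (Subtype.val '' X) := by
  rcases h with h | h
  · left
    rintro _ ⟨a, ha, rfl⟩
    exact h a ha
  · right
    rintro _ ⟨a, ha, rfl⟩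
    exact h a ha

theorem homog_of_image_val {U : Set V} {X : Set U} {v : U} (h : Homog G v (Subtype.val '' X)) :
    Homog (G.induce U) v X :=
  h.imp (fun h a ha => h a.1 ⟨a, ha, rfl⟩) fun h a ha => h a.1 ⟨a, ha, rfl⟩

/-- A stuck indecomposable set contains no prime node properly. -/
theorem Stuck.eq_of_subset [Finite V] (hG : IsPrimeGraph G) (hr : IsRealiser G σ τ)
    {i : Bool} {q : V} {M X : Set V} (h : Stuck G σ τ s i q M) (hd : ¬ Decomposable G M)
    (hXM : X ⊆ M) (hnt : X.Nontrivial) (hmod : ∀ v ∈ side G s i, v ∉ X → Homog G v X)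
    (hX : ∀ x ∈ X, ¬ Homog G x (X \ {x})) : X = M := by
  by_contra hne
  -- `C` is a maximal proper subset of `M` that contains `X` and is split by no vertex of `M`. The
  -- contradiction will be that `C` and `M \ C` decompose `M`.
  obtain ⟨C, hXC, hC⟩ := Set.Finite.exists_le_maximal
    (s := {K : Set V | X ⊆ K ∧ K ⊂ M ∧ ∀ v ∈ M \ K, Homog G v K}) (Set.toFinite _)
    ⟨subset_rfl, hXM.ssubset_of_ne hne, fun v hv => hmod v (h.subset hv.1) hv.2⟩
  have hXC' : X ⊆ C := hXC
  obtain ⟨-, hCM, hCmod⟩ := hC.prop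
  obtain ⟨y₀, hy₀M, hy₀C⟩ := Set.exists_of_ssubset hCM
  have hqX : ¬ Homog G q X := h.not_homog_of_subset hG hr hXM hnt fun v hv =>
    hmod v (h.subset hv.1) hv.2
  obtain ⟨𝒬, A, B, hc, hA, hB, hMAB, -, -, hqA, hqB⟩ := h.chain
  have hXA : (A ∩ X).Nonempty := by
    by_contra hcon
    refine hqX (hqB.mono fun x hx => ⟨(hMAB (hXM hx)).resolve_left fun h' => hcon ⟨x, h', hx⟩, ?_⟩)
    exact hXM hx
  have hXB : (B ∩ X).Nonempty := by
    by_contra hcon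
    refine hqX (hqA.mono fun x hx => ⟨(hMAB (hXM hx)).resolve_right fun h' => hcon ⟨x, h', hx⟩, ?_⟩)
    exact hXM hx
  -- This is the first merge creating a part that meets both `X` and `M \ C`. Such a part exists at
  -- the end: `q` splits `X` but neither `A ∩ M` nor `B ∩ M`, so both `A` and `B` meet `X`, and one
  -- of them meets `M \ C`.
  obtain ⟨𝒜, Z₁, Z₂, hZ₁, hZ₂, hZ, hcA, hφ, hφ', hcM, href⟩ := hc.exists_step
    (fun 𝒜 => ∀ Z ∈ 𝒜, (Z ∩ X).Nonempty → (Z ∩ (M \ C)).Nonempty → False)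
    (by
      rintro _ ⟨v, rfl⟩ ⟨a, ha, haX⟩ ⟨b, hb, hbC⟩
      rw [Set.mem_singleton_iff] at ha hb
      subst ha; subst hb
      exact hbC.2 (hXC' haX))
    (fun hcon => by
      rcases hMAB hy₀M with h' | h'
      · exact hcon A hA hXA ⟨y₀, h', hy₀M, hy₀C⟩
      · exact hcon B hB hXB ⟨y₀, h', hy₀M, hy₀C⟩)
  push Not at hφ'
  obtain ⟨Z, hZm, hZX, hZC, -⟩ := hφ'
  have hpA := hcA.isParts
  have hpQ := hc.isParts
  have hZe : Z = Z₁ ∪ Z₂ := by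
    rcases hZm with e | e
    · exact e
    · exact (hφ Z e.1 hZX hZC).elim
  subst hZe
  wlog hZX₁ : (Z₁ ∩ X).Nonempty generalizing Z₁ Z₂
  · have hcomm : mergeParts 𝒜 Z₂ Z₁ = mergeParts 𝒜 Z₁ Z₂ := by
      unfold mergeParts
      rw [Set.union_comm, Set.insert_comm]
    rw [← hcomm] at hcM href hZm
    rw [Set.union_comm] at hZm hZX hZC
    refine this Z₂ Z₁ hZ₂ hZ₁ hZ.symm hcM href hZm hZX hZC ?_
    obtain ⟨x, hx | hx, hxX⟩ := hZX
    · exact ⟨x, hx, hxX⟩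
    · exact (hZX₁ ⟨x, hx, hxX⟩).elim
  have hZ₁C : ∀ v ∈ Z₁, v ∈ M → v ∈ C := fun v hv hvM => by
    by_contra hvC
    exact hφ Z₁ hZ₁ hZX₁ ⟨v, hv, hvM, hvC⟩
  obtain ⟨y, hyZ, hyM, hyC⟩ : (Z₂ ∩ (M \ C)).Nonempty := by
    obtain ⟨v, hv | hv, hvM⟩ := hZC
    · exact (hvM.2 (hZ₁C v hv hvM.1)).elim
    · exact ⟨v, hv, hvM⟩
  have hZ₂X : ∀ v ∈ Z₂, v ∉ X := fun v hv hvX => hφ Z₂ hZ₂ ⟨v, hv, hvX⟩ ⟨y, hyZ, hyM, hyC⟩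
  have hyhom := hCmod y ⟨hyM, hyC⟩
  obtain ⟨x, hxZ, hxX⟩ := hZX₁
  have hqZ : Homog G q (Z₁ ∩ X) := by
    obtain ⟨R, hR, hRs⟩ := href _ (Or.inl rfl)
    have hxR : x ∈ R := hRs (Or.inl hxZ)
    rcases hMAB (hXM hxX) with h' | h'
    · have := hpQ.2.2 R hR A hA x hxR h'
      subst this
      exact hqA.mono fun v hv => ⟨hRs (Or.inl hv.1), hXM hv.2⟩
    · have := hpQ.2.2 R hR B hB x hxR h'
      subst this
      exact hqB.mono fun v hv => ⟨hRs (Or.inl hv.1), hXM hv.2⟩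
  -- If `Z₁ ∩ X` has two vertices, it is not split by `q`, so some vertex of `X` splits it. If it is
  -- `{x}`, then `x` has a neighbour and a non-neighbour in the rest of `X` while `y` does not
  -- distinguish them, so one of these separates `x` from `y`.
  obtain ⟨v, hvX, hvZ, hvm⟩ : ∃ v ∈ X, v ∉ Z₁ ∧ Mixed G {v} (Z₁ ∪ Z₂) := by
    by_cases hY : (Z₁ ∩ X).Nontrivial
    · by_contra hcon
      push Not at hcon
      refine h.not_homog_of_subset hG hr (fun a ha => hXM ha.2) hY (fun v hv => ?_) hqZ
      by_cases hvX : v ∈ X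
      · have hvZ : v ∉ Z₁ := fun h' => hv.2 ⟨h', hvX⟩
        by_contra hn
        exact hcon v hvX hvZ ((mixed_singleton_iff.2 hn).mono subset_rfl
          (Set.inter_subset_left.trans Set.subset_union_left))
      · exact (hmod v (h.subset hv.1) hvX).mono Set.inter_subset_right
    · have hYs := Set.not_nontrivial_iff.1 hY
      obtain ⟨⟨a, ha, hxa⟩, b, hb, hxb⟩ := not_homog_iff.1 (hX x hxX)
      have hnZ : ∀ c ∈ X \ {x}, c ∉ Z₁ := fun c hc hcZ => hc.2 (hYs ⟨hcZ, hc.1⟩ ⟨hxZ, hxX⟩)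
      rcases hyhom with hy | hy
      · exact ⟨b, hb.1, hnZ b hb, ⟨b, rfl, y, Or.inr hyZ, (hy b (hXC' hb.1)).symm⟩,
          b, rfl, x, Or.inl hxZ, fun h' => hxb h'.symm⟩
      · exact ⟨a, ha.1, hnZ a ha, ⟨a, rfl, x, Or.inl hxZ, hxa.symm⟩,
          a, rfl, y, Or.inr hyZ, fun h' => hy a (hXC' ha.1) h'.symm⟩
  obtain ⟨Y, hY, hvY⟩ := hpA.2.1 v
  have hYZ₁ : Y ≠ Z₁ := fun e => hvZ (e ▸ hvY)
  have hYZ₂ : Y ≠ Z₂ := fun e => hZ₂X v (e ▸ hvY) hvX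
  have hU := hpA.union_notMem hZ₁ hZ₂ hZ
  have hUne : ∀ W ∈ 𝒜, Z₁ ∪ Z₂ ≠ W := fun W hW e => hU (e ▸ hW)
  have hmem : ∀ W ∈ 𝒜, W ≠ Z₁ → W ≠ Z₂ → W ∈ mergeParts 𝒜 Z₁ Z₂ := by
    intro W hW h1 h2
    refine Or.inr ⟨hW, ?_⟩
    rintro (e | e | e)
    exacts [h1 e, h2 e, hUne W hW (Set.mem_singleton_iff.1 e).symm]
  have hYm : Mixed G (Z₁ ∪ Z₂) Y := (hvm.mono (Set.singleton_subset_iff.2 hvY) subset_rfl).symm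
  -- The part `Y` of `v` is the only one mixed with `Z₁ ∪ Z₂`. It meets `X`, so it contains no
  -- vertex of `M \ C`, and `w` lies in a part that is not mixed with `Z₁ ∪ Z₂`.
  have hKmod : ∀ w ∈ M \ (C ∪ Z₂ ∩ M), Homog G w (C ∪ Z₂ ∩ M) := by
    rintro w ⟨hwM, hwK⟩
    have hwC : w ∉ C := fun h' => hwK (Or.inl h')
    have hwZ₂ : w ∉ Z₂ := fun h' => hwK (Or.inr ⟨h', hwM⟩)
    have hwZ₁ : w ∉ Z₁ := fun h' => hwC (hZ₁C w h' hwM)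
    obtain ⟨W, hW, hwW⟩ := hpA.2.1 w
    have hW1 : W ≠ Z₁ := fun e => hwZ₁ (e ▸ hwW)
    have hW2 : W ≠ Z₂ := fun e => hwZ₂ (e ▸ hwW)
    have hWY : W ≠ Y := by
      rintro rfl
      exact hφ W hW ⟨v, hvY, hvX⟩ ⟨w, hwW, hwM, hwC⟩
    have hnm : ¬ Mixed G W (Z₁ ∪ Z₂) := fun hm => hWY (hcM.deg1 _ (Or.inl rfl) W
      (hmem W hW hW1 hW2) Y (hmem Y hY hYZ₁ hYZ₂) (hUne W hW) (hUne Y hY) hm.symm hYm)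
    have h1 := not_mixed_left hnm hwW
    have h2 := hCmod w ⟨hwM, hwC⟩
    have key : ∀ a ∈ C ∪ Z₂ ∩ M, (G.Adj w a ↔ G.Adj w x) := by
      rintro a (ha | ha)
      exacts [h2.adj_iff ha (hXC' hxX), h1.adj_iff (Or.inr ha.1) (Or.inl hxZ)]
    exact homog_of_adj_iff fun a ha b hb => (key a ha).trans (key b hb).symm
  have hK : C ∪ Z₂ ∩ M = M := by
    by_contra hKne
    have hKM : C ∪ Z₂ ∩ M ⊆ M := Set.union_subset hCM.subset Set.inter_subset_right
    have := hC.eq_of_subset ⟨hXC'.trans Set.subset_union_left, hKM.ssubset_of_ne hKne, hKmod⟩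
      Set.subset_union_left
    exact hyC (this ▸ Or.inr ⟨hyZ, hyM⟩)
  have hMZ : M \ C ⊆ Z₂ := by
    rintro w ⟨hwM, hwC⟩
    rw [← hK] at hwM
    exact (hwM.resolve_left hwC).1
  refine hd ⟨C, M \ C, ⟨x, hXC' hxX⟩, ⟨y, hyM, hyC⟩, Set.disjoint_sdiff_right,
    Set.union_sdiff_cancel hCM.subset, ?_⟩
  rintro ⟨⟨c₁, hc₁, z₁, hz₁, h1⟩, c₂, hc₂, z₂, hz₂, h2⟩
  -- The vertices of `M \ C` lie in `Z₂` and do not distinguish vertices of `C`. A mixed pair `C`,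
  -- `M \ C` would thus make `Z₂` mixed with every part meeting `X`, in particular with both `Y` and
  -- `Z₁`.
  have key : ∀ P, ∀ c ∈ P, c ∈ X → Mixed G Z₂ P := by
    intro P c hcP hcX
    refine ⟨⟨z₁, hMZ hz₁, c, hcP, ?_⟩, z₂, hMZ hz₂, c, hcP, ?_⟩
    · exact ((hCmod z₁ hz₁).adj_iff hc₁ (hXC' hcX)).1 h1.symm
    · exact fun h' => h2 (((hCmod z₂ hz₂).adj_iff hc₂ (hXC' hcX)).2 h').symm
  exact hYZ₁ (hcA.deg1 Z₂ hZ₂ Y hY Z₁ hZ₁ hYZ₂.symm hZ.symm (key Y v hvY hvX) (key Z₁ x hxZ hxX))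

/-- A prime node of a side that is contained in a grown set is contained in the initial set. -/
theorem Grow.subset_of_isPrimeNode [Finite V] (hr : IsRealiser G σ τ) {S₀ S : Set V}
    (h : Grow G σ τ s S₀ S) {j : Bool} {X : Set (side G s j)}
    (hX : IsPrimeNode (G.induce (side G s j)) X) (hXS : Subtype.val '' X ⊆ S) :
    Subtype.val '' X ⊆ S₀ := by
  induction h with
  | refl => exact hXS
  | @insert S v _ hv hg _ ih =>
    refine ih ?_
    by_contra hcon
    obtain ⟨_, ⟨x, hx, rfl⟩, hxS⟩ := Set.not_subset.1 hcon
    have hxv : (x : V) = v := (hXS ⟨x, hx, rfl⟩).resolve_right hxS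
    have hP : IsModule (G.induce (side G s j)) (Subtype.val ⁻¹' S) :=
      isModule_induce fun w _ hw => hg.homog hr hw j
    have hmem : ∀ y ∈ X, y ≠ x → (y : V) ∈ S := fun y hy hyx =>
      (hXS ⟨y, hy, rfl⟩).resolve_left fun e => hyx (Subtype.ext (e.trans hxv.symm))
    -- The trace of `S` is a module and `X` has only `x` outside it. As `X` is strong, either it
    -- contains the trace, so that `X \ {x}` is a module, or it is disjoint from the trace, hence a
    -- single vertex.
    rcases hX.1.2.2 _ hP with h1 | h1 | h1
    · exact hxS (h1 hx)
    · refine hX.not_isModule_sdiff hx ?_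
      have : X \ {x} = Subtype.val ⁻¹' S := by
        ext y
        exact ⟨fun hy => hmem y hy.1 hy.2, fun hy => ⟨h1 hy, by rintro rfl; exact hxS hy⟩⟩
      rwa [this]
    · obtain ⟨y, hy, hyx⟩ := hX.2.1.exists_ne x
      exact Set.disjoint_left.1 h1 hy (hmem y hy hyx)

theorem Grow.subset {S₀ S : Set V} (h : Grow G σ τ s S₀ S) : S₀ ⊆ S := by
  induction h with
  | refl => exact subset_rfl
  | insert _ _ _ _ ih => exact ih.trans (Set.subset_insert _ _)

/-- The vertices of `S \ S₀` can be ordered so that adding them one after the other to `S₀` gives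
sets with the property `φ`. -/
def Enumerable (φ : Set V → Prop) (S₀ S : Set V) : Prop :=
  ∃ (k : ℕ) (f : ℕ → V), (∀ a < k, ∀ b < k, f a = f b → a = b) ∧
    (∀ x, x ∈ S \ S₀ ↔ ∃ a < k, f a = x) ∧ ∀ j < k, φ (S₀ ∪ {x | ∃ l ≤ j, f l = x})

theorem Enumerable.insert {φ : Set V → Prop} {S₀ S : Set V} (h : Enumerable φ S₀ S)
    (hS : S₀ ⊆ S) {v : V} (hv : v ∉ S) (hφ : φ (insert v S)) : Enumerable φ S₀ (insert v S) := by
  obtain ⟨k, f, h1, h2, h3⟩ := h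
  have hlt : ∀ a < k, Function.update f k v a = f a := fun a ha =>
    Function.update_of_ne ha.ne _ _
  have hk : Function.update f k v k = v := Function.update_self _ _ _
  have hfv : ∀ a < k, f a ≠ v := fun a ha e => hv (e ▸ ((h2 _).2 ⟨a, ha, rfl⟩).1)
  refine ⟨k + 1, Function.update f k v, ?_, fun x => ?_, fun j hj => ?_⟩
  · intro a ha b hb hab
    rcases (Nat.lt_succ_iff_lt_or_eq.1 ha) with ha | rfl <;>
      rcases (Nat.lt_succ_iff_lt_or_eq.1 hb) with hb | rfl
    · rw [hlt a ha, hlt b hb] at hab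
      exact h1 a ha b hb hab
    · rw [hlt a ha, hk] at hab
      exact (hfv a ha hab).elim
    · rw [hlt b hb, hk] at hab
      exact (hfv b hb hab.symm).elim
    · rfl
  · constructor
    · rintro ⟨rfl | hx, hx0⟩
      · exact ⟨k, k.lt_succ_self, hk⟩
      · obtain ⟨a, ha, hax⟩ := (h2 x).1 ⟨hx, hx0⟩
        exact ⟨a, ha.trans k.lt_succ_self, by rw [hlt a ha, hax]⟩
    · rintro ⟨a, ha, rfl⟩
      rcases (Nat.lt_succ_iff_lt_or_eq.1 ha) with ha | rfl
      · rw [hlt a ha]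
        have := (h2 (f a)).2 ⟨a, ha, rfl⟩
        exact ⟨Or.inr this.1, this.2⟩
      · rw [hk]
        exact ⟨Or.inl rfl, fun h' => hv (hS h')⟩
  · rcases (Nat.lt_succ_iff_lt_or_eq.1 hj) with hj | rfl
    · have : {x | ∃ l ≤ j, Function.update f k v l = x} = {x | ∃ l ≤ j, f l = x} := by
        ext x
        exact exists_congr fun l => and_congr_right fun hl => by rw [hlt l (hl.trans_lt hj)]
      rw [this]
      exact h3 j hj
    · convert hφ using 1
      ext x
      constructor
      · rintro (hx | ⟨l, hl, rfl⟩)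
        · exact Or.inr (hS hx)
        · rcases hl.lt_or_eq with hl | rfl
          · rw [hlt l hl]
            exact Or.inr ((h2 _).2 ⟨l, hl, rfl⟩).1
          · exact Or.inl hk
      · rintro (rfl | hx)
        · exact Or.inr ⟨j, le_rfl, hk⟩
        · by_cases hx0 : x ∈ S₀
          · exact Or.inl hx0
          · obtain ⟨a, ha, hax⟩ := (h2 x).1 ⟨hx, hx0⟩
            exact Or.inr ⟨a, ha.le, by rw [hlt a ha, hax]⟩

theorem Enumerable.exists_equiv [Finite V] {φ : Set V → Prop} {S₀ : Set V}
    (h : Enumerable φ S₀ Set.univ) : ∃ π : Fin S₀ᶜ.ncard ≃ (S₀ᶜ : Set V),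
      ∀ k, φ (S₀ ∪ {v | ∃ j ≤ k, (π j : V) = v}) := by
  obtain ⟨k, f, h1, h2, h3⟩ := h
  have hmem : ∀ j : Fin k, f j ∈ S₀ᶜ := fun j => ((h2 _).2 ⟨j, j.2, rfl⟩).2
  have hbij : Function.Bijective fun j : Fin k => (⟨f j, hmem j⟩ : (S₀ᶜ : Set V)) := by
    constructor
    · intro a b hab
      exact Fin.ext (h1 a a.2 b b.2 (congrArg Subtype.val hab))
    · rintro ⟨x, hx⟩
      obtain ⟨a, ha, rfl⟩ := (h2 x).1 ⟨trivial, hx⟩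
      exact ⟨⟨a, ha⟩, rfl⟩
  have hk : k = S₀ᶜ.ncard := by
    rw [← Nat.card_coe_set_eq, ← Nat.card_congr (Equiv.ofBijective _ hbij), Nat.card_fin]
  subst hk
  refine ⟨Equiv.ofBijective _ hbij, fun k => ?_⟩
  convert h3 k k.2 using 2
  ext v
  constructor
  · rintro ⟨j, hj, rfl⟩
    exact ⟨j, hj, rfl⟩
  · rintro ⟨l, hl, rfl⟩
    exact ⟨⟨l, hl.trans_lt k.2⟩, hl, rfl⟩

theorem isInterval_of_btw {I : Set V} (h : ∀ a ∈ I, ∀ b ∈ I, ∀ c, Btw σ a c b → c ∈ I) :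
    IsInterval σ I := by
  refine ⟨Set.subset_univ _, fun u hu v hv w _ h1 h2 => ?_⟩
  rcases h1.lt_or_eq with h1 | h1
  · rcases h2.lt_or_eq with h2 | h2
    · exact h u hu v hv w (Or.inl ⟨h1, h2⟩)
    · exact σ.injective h2 ▸ hv
  · exact σ.injective h1 ▸ hu

theorem Good.isIntervalAndTwoIntervals (hr : IsRealiser G σ τ) (hs : IsEndpoint σ s) {S : Set V}
    (h : Good G σ τ s S) : IsIntervalAndTwoIntervals σ τ S := by
  have key : ∀ i, IsInterval τ (S ∩ side G s i) := fun i =>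
    isInterval_of_btw fun a ha b hb c hc => ⟨h.tau i a ha b hb c hc, by
      by_contra hcon
      exact not_btw_side hr hs ha.2 hb.2 hcon hc⟩
  refine ⟨isInterval_of_btw h.sigma, _, _, h.nonempty true, h.nonempty false, ?_, ?_, key true,
    key false⟩
  · exact Set.disjoint_left.2 fun x hx hx' => notMem_side_not hx.2 hx'.2
  · ext x
    exact ⟨fun hx => hx.elim And.left And.left, fun hx => h.mem_or hx true⟩

/-- `Good` excludes `s`, so the last step is separate: in `τ`, `s` lies between its two sides and
can be attached to its neighbours. -/
theorem isIntervalAndTwoIntervals_univ (hr : IsRealiser G σ τ) (hs : IsEndpoint σ s)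
    (hne : (side G s false).Nonempty) : IsIntervalAndTwoIntervals σ τ Set.univ := by
  have hmem : ∀ x, x ∉ side G s false → x ∈ insert s (side G s true) := by
    intro x hx
    by_cases hxs : x = s
    · exact Or.inl hxs
    · exact Or.inr ((mem_side_or G true hxs).resolve_right hx)
  refine ⟨isInterval_of_btw fun _ _ _ _ _ _ => trivial, insert s (side G s true), side G s false,
    ⟨s, Or.inl rfl⟩, hne, ?_, ?_, ?_, ?_⟩
  · rw [Set.disjoint_left]
    rintro x (rfl | hx) hx'
    exacts [notMem_side G x _ hx', notMem_side_not hx hx']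
  · ext x
    refine iff_of_true ?_ trivial
    by_cases hx : x ∈ side G s false
    exacts [Or.inr hx, Or.inl (hmem x hx)]
  · refine isInterval_of_btw fun a ha b hb c hc => hmem c fun hc' => ?_
    rcases ha with rfl | ha <;> rcases hb with rfl | hb
    · unfold Btw at hc; grind
    · have := btw_endpoint hr hs hb hc'
      unfold Btw at *; grind
    · have := btw_endpoint hr hs ha hc'
      unfold Btw at *; grind
    · exact not_btw_side hr hs ha hb (notMem_side_of_not (i := true) hc') hc
  · refine isInterval_of_btw fun a ha b hb c hc => ?_
    by_contra hcon
    exact not_btw_side hr hs ha hb hcon hc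

theorem Grow.enumerable (hr : IsRealiser G σ τ) (hs : IsEndpoint σ s) {S₀ S : Set V}
    (h : Grow G σ τ s S₀ S) : Enumerable (IsIntervalAndTwoIntervals σ τ) S₀ S := by
  induction h with
  | refl =>
    refine ⟨0, fun _ => s, fun a ha => (Nat.not_lt_zero a ha).elim, fun x => ?_,
      fun j hj => (Nat.not_lt_zero j hj).elim⟩
    exact ⟨fun h => (h.2 h.1).elim, fun ⟨a, ha, _⟩ => (Nat.not_lt_zero a ha).elim⟩
  | insert hgr hv _ hg ih => exact ih.insert hgr.subset hv (hg.isIntervalAndTwoIntervals hr hs)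

theorem good_compl_singleton (hr : IsRealiser G σ τ) (hs : IsEndpoint σ s)
    (hne : ∀ i, (side G s i).Nonempty) : Good G σ τ s {s}ᶜ := by
  refine ⟨fun h => h rfl, fun i => ?_, ?_, ?_⟩
  · obtain ⟨x, hx⟩ := hne i
    exact ⟨x, fun e => notMem_side G s i (Set.mem_singleton_iff.1 e ▸ hx), hx⟩
  · rintro a - b - c hc rfl
    exact hs.not_btw a b hc
  · rintro i a ha b hb c hc rfl
    exact not_btw_endpoint hr hs ha.2 hb.2 hc

/-- With one neighbour `a` and one non-neighbour `b` of `s`, either `{s, b}` or `{s, a}` is a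
module, according to whether `a` and `b` are adjacent. -/
theorem three_le_ncard_compl_singleton [Finite V] (hG : IsPrimeGraph G)
    (hne : ∀ i, (side G s i).Nonempty) : 3 ≤ ({s}ᶜ : Set V).ncard := by
  by_contra hlt
  obtain ⟨a, ha⟩ := hne true
  obtain ⟨b, hb⟩ := hne false
  have has : a ≠ s := ne_of_mem_of_not_mem ha (notMem_side G s _)
  have hbs : b ≠ s := hb.1
  have hab : a ≠ b := fun e => notMem_side_not ha (e ▸ hb)
  have hpair : ({a, b} : Set V) = {s}ᶜ := by
    refine Set.eq_of_subset_of_ncard_le ?_ (by rw [Set.ncard_pair hab]; omega)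
    rintro x (rfl | rfl)
    exacts [has, hbs]
  have hcov : ∀ v, v ≠ s → v ≠ a → v = b := fun v h1 h2 =>
    (hpair ▸ (h1 : v ∈ ({s}ᶜ : Set V)) : v ∈ ({a, b} : Set V)).resolve_left h2
  by_cases hadj : G.Adj a b
  · have ha' : G.Adj s a := ha
    obtain ⟨v, hv, hvn⟩ := hG.exists_not_homog (N := {s, b}) (Set.nontrivial_pair hbs.symm)
      fun e => (e ▸ Set.mem_univ a : a ∈ ({s, b} : Set V)).elim has hab
    have hva : v = a := by
      by_contra h'
      exact hv (Or.inr (hcov v (fun e => hv (Or.inl e)) h'))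
    subst hva
    refine hvn (Or.inl ?_)
    rintro x (rfl | rfl)
    exacts [ha'.symm, hadj]
  · obtain ⟨v, hv, hvn⟩ := hG.exists_not_homog (N := {s, a}) (Set.nontrivial_pair has.symm)
      fun e => (e ▸ Set.mem_univ b : b ∈ ({s, a} : Set V)).elim hbs hab.symm
    have hvb : v = b := hcov v (fun e => hv (Or.inl e)) fun e => hv (Or.inr e)
    subst hvb
    refine hvn (Or.inr ?_)
    rintro x (rfl | rfl)
    exacts [fun h => hb.2 h.symm, fun h => hadj h.symm]

/-- The graph induced by a stuck set has a `1`-sequence with `q` last. -/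
theorem Stuck.exists_seq [Finite V] (hG : IsPrimeGraph G) (hr : IsRealiser G σ τ) {i : Bool}
    {q : V} {M : Set V} (h : Stuck G σ τ s i q M) :
    ∃ T, IsDSequence (G.induce (insert q M)) 1 T ∧
      IsLastRedIncident T ⟨q, Set.mem_insert q M⟩ := by
  have hqM := h.not_homog hG hr
  obtain ⟨𝒬, A, B, hc, hA, hB, hMAB, hqA, hqB, hA', hB'⟩ := h.chain
  have hp := hc.isParts
  have hM : ∀ x : (insert q M : Set V), (x : V) ≠ q → (x : V) ∈ M := fun x hx =>
    x.2.resolve_left hx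
  have hAne : ∃ a ∈ A, a ∈ M := by
    by_contra hcon
    push Not at hcon
    exact hqM (hB'.mono fun x hx => ⟨(hMAB hx).resolve_left fun h' => hcon x h' hx, hx⟩)
  have hBne : ∃ a ∈ B, a ∈ M := by
    by_contra hcon
    push Not at hcon
    exact hqM (hA'.mono fun x hx => ⟨(hMAB hx).resolve_right fun h' => hcon x h' hx, hx⟩)
  have hAB : A ≠ B := by
    rintro rfl
    exact hqM (hA'.mono fun x hx => ⟨(hMAB hx).elim id id, hx⟩)
  let f : ↥(insert q M) → V := Subtype.val
  -- `A` and `B` cover `M` and miss `q`, so the part of `q` meets `M ∪ {q}` only in `q`.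
  have hpull : pullParts f 𝒬 = {f ⁻¹' A, f ⁻¹' B, {⟨q, Set.mem_insert q M⟩}} := by
    obtain ⟨R, hR, hqR⟩ := hp.2.1 q
    have hRM : ∀ x ∈ R, x ∉ M := by
      intro x hx hxM
      rcases hMAB hxM with h' | h'
      · exact hqA (hp.2.2 R hR A hA x hx h' ▸ hqR)
      · exact hqB (hp.2.2 R hR B hB x hx h' ▸ hqR)
    have hRq : f ⁻¹' R = {⟨q, Set.mem_insert q M⟩} := by
      ext x
      constructor
      · intro hx
        by_contra hxq
        exact hRM x hx (hM x fun e => hxq (Subtype.ext e))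
      · rintro rfl
        exact hqR
    ext N
    constructor
    · rintro ⟨⟨x, hx⟩, P, hP, rfl⟩
      by_cases hxq : (x : V) = q
      · have : P = R := hp.2.2 P hP R hR q (hxq ▸ hx : q ∈ P) hqR
        exact Or.inr (Or.inr (this ▸ hRq))
      · rcases hMAB (hM x hxq) with h' | h'
        · exact Or.inl (hp.2.2 P hP A hA x hx h' ▸ rfl)
        · exact Or.inr (Or.inl (hp.2.2 P hP B hB x hx h' ▸ rfl))
    · rintro (rfl | rfl | rfl)
      · obtain ⟨a, ha, haM⟩ := hAne
        exact ⟨⟨⟨a, Or.inr haM⟩, ha⟩, A, hA, rfl⟩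
      · obtain ⟨a, ha, haM⟩ := hBne
        exact ⟨⟨⟨a, Or.inr haM⟩, ha⟩, B, hB, rfl⟩
      · exact ⟨Set.singleton_nonempty _, R, hR, hRq⟩
  have hcp := hc.pull (f := f) Subtype.val_injective
  rw [hpull] at hcp
  have key : ∀ P : Set V, q ∉ P → Homog G q (P ∩ M) →
      Homog (G.comap f) ⟨q, Set.mem_insert q M⟩ (f ⁻¹' P) := by
    intro P hqP hPM
    exact hPM.imp
      (fun h' x hx => h' x ⟨hx, hM x (ne_of_mem_of_not_mem (s := P) hx hqP)⟩)
      (fun h' x hx => h' x ⟨hx, hM x (ne_of_mem_of_not_mem (s := P) hx hqP)⟩)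
  refine exists_seq_last_red hcp ?_ hqA hqB (key A hqA hA') (key B hqB hB') ?_
  · intro e
    obtain ⟨a, ha, haM⟩ := hAne
    have : (⟨a, Or.inr haM⟩ : (insert q M : Set V)) ∈ f ⁻¹' B := e ▸ ha
    exact hAB (hp.2.2 A hA B hB a ha this)
  · intro hh
    exact hqM (hh.imp (fun h' x hx => h' ⟨x, Or.inr hx⟩ (hMAB hx))
      fun h' x hx => h' ⟨x, Or.inr hx⟩ (hMAB hx))

theorem not_decomposable_induce {U M : Set V} (hMU : M ⊆ U) (hd : ¬ Decomposable G M) :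
    ¬ Decomposable (G.induce U) (Subtype.val ⁻¹' M) := by
  rintro ⟨N₁, N₂, h1, h2, h3, h4, h5⟩
  refine hd ⟨Subtype.val '' N₁, Subtype.val '' N₂, h1.image _, h2.image _,
    (Set.disjoint_image_iff Subtype.val_injective).2 h3, ?_, ?_⟩
  · rw [← Set.image_union, h4, Subtype.image_preimage_coe, Set.inter_eq_right.2 hMU]
  · rintro ⟨⟨_, ⟨a, ha, rfl⟩, _, ⟨b, hb, rfl⟩, hab⟩, _, ⟨c, hc, rfl⟩, _, ⟨d, hd, rfl⟩, hcd⟩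
    exact h5 ⟨⟨a, ha, b, hb, hab⟩, c, hc, d, hd, hcd⟩

theorem isModule_of_subsingleton {N : Set V} (h : N.Subsingleton) : IsModule G N :=
  fun _ _ => homog_of_adj_iff fun a ha b hb => by rw [h ha hb]

theorem Stuck.isModule_induce (hr : IsRealiser G σ τ) {i : Bool} {q : V} {M : Set V}
    (h : Stuck G σ τ s i q M) : IsModule (G.induce (side G s i)) (Subtype.val ⁻¹' M) :=
  TwinWidthOne.isModule_induce fun _ hv hvM =>
    (h.homog hr hvM fun e => notMem_side_of_not h.mem (e ▸ hv)).mono Set.inter_subset_left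

theorem Stuck.isSplitter_iff (hG : IsPrimeGraph G) (hr : IsRealiser G σ τ) {i : Bool} {q : V}
    {M : Set V} (h : Stuck G σ τ s i q M) (v : V) : IsSplitter G M v ↔ v = q := by
  constructor
  · rintro ⟨hv, hsp⟩
    by_contra hvq
    exact not_homog_iff.2 hsp (h.homog hr hv hvq)
  · rintro rfl
    exact ⟨h.notMem, not_homog_iff.1 (h.not_homog hG hr)⟩

/-- A stuck pair consists of twins of its side that are consecutive in `τ`. -/
theorem Stuck.exists_twins (hr : IsRealiser G σ τ) {i : Bool} {q : V} {M : Set V}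
    (h : Stuck G σ τ s i q M) (h2 : M.ncard = 2) :
    ∃ a b : side G s i, AreTwins (G.induce (side G s i)) a b ∧ M = {(a : V), (b : V)} ∧
      IsIntervalOn τ (side G s i) M := by
  obtain ⟨a, b, hab, rfl⟩ := Set.ncard_eq_two.1 h2
  have ha : a ∈ side G s i := h.subset (Or.inl rfl)
  have hb : b ∈ side G s i := h.subset (Or.inr rfl)
  have hq : ∀ v ∈ side G s i, v ≠ q := fun v hv e => notMem_side_of_not h.mem (e ▸ hv)
  have hadj : ∀ x ∈ side G s i, x ≠ a → x ≠ b → (G.Adj a x ↔ G.Adj b x) := by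
    intro x hx h1 h2
    rw [G.adj_comm a, G.adj_comm b]
    exact (h.homog hr (by rintro (e | e); exacts [h1 e, h2 e]) (hq x hx)).adj_iff (Or.inl rfl)
      (Or.inr rfl)
  refine ⟨⟨a, ha⟩, ⟨b, hb⟩, ⟨fun e => hab (congrArg Subtype.val e), ?_⟩, rfl, h.subset, ?_⟩
  · ext ⟨x, hx⟩
    simp only [Set.mem_sdiff, SimpleGraph.mem_neighborSet, SimpleGraph.comap_adj,
      Function.Embedding.subtype_apply, Set.mem_singleton_iff, Subtype.mk.injEq]
    constructor
    · rintro ⟨h1, h2⟩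
      exact ⟨(hadj x hx h1.ne' h2).1 h1, h1.ne'⟩
    · rintro ⟨h1, h2⟩
      exact ⟨(hadj x hx h2 h1.ne').2 h1, h1.ne'⟩
  · intro u hu v hv w hw h1 h2
    rcases h1.lt_or_eq with h1 | h1
    · rcases h2.lt_or_eq with h2 | h2
      · have := h.good.tau i u ⟨Or.inr hu, h.subset hu⟩ v ⟨Or.inr hv, h.subset hv⟩ w
          (Or.inl ⟨h1, h2⟩)
        exact this.resolve_left (hq w hw)
      · exact τ.injective h2 ▸ hv
    · exact τ.injective h1 ▸ hu

theorem Stuck.subset_of_isPrimeNode {i : Bool} {q : V} {M : Set V}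
    (h : Stuck G σ τ s i q M) {j : Bool} {X : Set (side G s j)}
    (hX : IsPrimeNode (G.induce (side G s j)) X) (hXM : Subtype.val '' X ⊆ insert q M) :
    j = i ∧ Subtype.val '' X ⊆ M := by
  rcases eq_or_eq_not i j with rfl | rfl
  · refine ⟨rfl, ?_⟩
    rintro _ ⟨x, hx, rfl⟩
    exact (hXM ⟨x, hx, rfl⟩).resolve_left fun e => notMem_side_of_not h.mem (e ▸ x.2)
  · exfalso
    have key : ∀ x ∈ X, (x : V) = q := fun x hx =>
      (hXM ⟨x, hx, rfl⟩).resolve_right fun h' => notMem_side_not (h.subset h') x.2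
    exact Set.not_subsingleton_iff.2 hX.2.1 fun x hx y hy =>
      Subtype.ext ((key x hx).trans (key y hy).symm)

end Main

end TwinWidthOne

open TwinWidthOne
theorem mainTheorem5 {V : Type*} [Finite V] (G : SimpleGraph V)
    (hprime : IsPrimeGraph G) (htww : twinWidth G = 1)
    (σ τ : V ≃ Fin (Nat.card V)) (hrealiser : IsRealiser G σ τ)
    (s : V) (hextremal : IsEndpoint σ s)
    (hlast : ∃ T, IsDSequence G 1 T ∧ IsLastRedIncident T s) :
    ∃ (i : Bool) (M : Set V) (s' : V),
      -- `M` is a module of `G^i` with unique splitter `s'`, which lies on the other side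
      M ⊆ side G s i ∧
      IsModule (G.induce (side G s i)) (Subtype.val ⁻¹' M) ∧
      s' ∈ side G s (!i) ∧
      (∀ v, IsSplitter G M v ↔ v = s') ∧
      -- `G[M ∪ {s'}]` has a `1`-sequence where `s'` is last to be incident to a red edge
      (∃ T, IsDSequence (G.induce (insert s' M)) 1 T ∧
        IsLastRedIncident T ⟨s', Set.mem_insert s' M⟩) ∧
      -- the two possibilities for `M`
      (((∃ a b : side G s i,
            AreTwins (G.induce (side G s i)) a b ∧
            M = {(a : V), (b : V)} ∧
            (IsIntervalOn σ (side G s i) M ∨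
              IsIntervalOn τ (side G s i) M)) ∧
          ∀ (j : Bool) (X : Set (side G s j)),
            ¬ IsPrimeNode (G.induce (side G s j)) X) ∨
        (IsPrimeNode (G.induce (side G s i)) (Subtype.val ⁻¹' M) ∧
          ∀ (j : Bool) (X : Set (side G s j)),
            IsPrimeNode (G.induce (side G s j)) X →
              j = i ∧ Subtype.val '' X = M)) ∧
      -- the ordering of the remaining vertices
      ∃ π : Fin (insert s' M)ᶜ.ncard ≃ ((insert s' M)ᶜ : Set V),
        ∀ k, IsIntervalAndTwoIntervals σ τ (insert s' M ∪ {v | ∃ j ≤ k, (π j : V) = v}) := by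
  obtain ⟨T, hT, hTs⟩ := hlast
  obtain ⟨𝒬, hc, -, hside⟩ := exists_chain_sides hprime hT hTs
  have hne : ∀ i, (side G s i).Nonempty := fun i => hc.isParts.1 _ (hside i)
  obtain ⟨i, q, P, hP, hgrP⟩ := (good_compl_singleton hrealiser hextremal hne).exists_stuck hprime
    hrealiser hextremal hc hside (three_le_ncard_compl_singleton hprime hne)
  obtain ⟨M, hM, hgrM, hfin⟩ := hP.exists_reduced hprime hrealiser hextremal
  have hgr := hgrM.trans hgrP
  have hnode : ∀ (j : Bool) (X : Set (side G s j)), IsPrimeNode (G.induce (side G s j)) X →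
      j = i ∧ Subtype.val '' X ⊆ M := fun j X hX =>
    hM.subset_of_isPrimeNode hX (hgr.subset_of_isPrimeNode hrealiser hX (by
      rintro _ ⟨x, -, rfl⟩ e
      exact ne_of_mem_of_not_mem x.2 (notMem_side G s j) e))
  refine ⟨i, M, q, hM.subset, hM.isModule_induce hrealiser, hM.mem,
    hM.isSplitter_iff hprime hrealiser, hM.exists_seq hprime hrealiser, ?_, ?_⟩
  · by_cases h2 : M.ncard = 2
    · left
      obtain ⟨a, b, hab, hMab, hint⟩ := hM.exists_twins hrealiser h2
      refine ⟨⟨a, b, hab, hMab, Or.inr hint⟩, fun j X hX => ?_⟩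
      obtain ⟨x, hx⟩ := hX.1.1
      -- A prime node would lie inside the pair `M`, and removing one vertex from it would leave at
      -- most one, which is trivially a module.
      refine hX.not_isModule_sdiff hx (isModule_of_subsingleton ?_)
      have h3 := Set.ncard_le_ncard (hnode j X hX).2
      rw [Set.ncard_image_of_injective _ Subtype.val_injective, h2,
        ← Set.ncard_sdiff_singleton_add_one hx] at h3
      exact Set.ncard_le_one_iff_subsingleton.1 (by omega)
    · right
      have hd := hfin.resolve_left h2
      have hnt : (Subtype.val ⁻¹' M : Set (side G s i)).Nontrivial := by
        obtain ⟨a, ha, b, hb, hab⟩ := hM.nontrivial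
        exact ⟨⟨a, hM.subset ha⟩, ha, ⟨b, hM.subset hb⟩, hb, fun e => hab (congrArg Subtype.val e)⟩
      refine ⟨isPrimeNode_of_not_decomposable (hM.isModule_induce hrealiser) hnt
        (not_decomposable_induce hM.subset hd), fun j X hX => ?_⟩
      obtain ⟨rfl, hXM⟩ := hnode j X hX
      refine ⟨rfl, hM.eq_of_subset hprime hrealiser hd hXM
        (hX.2.1.image Subtype.val_injective) ?_ ?_⟩
      · intro v hv hvX
        exact homog_image_val (v := ⟨v, hv⟩) (hX.1.2.1 ⟨v, hv⟩ fun h' => hvX ⟨_, h', rfl⟩)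
      · rintro _ ⟨x, hx, rfl⟩ hh
        refine hX.not_homog_sdiff hx (homog_of_image_val ?_)
        rwa [Set.image_sdiff Subtype.val_injective, Set.image_singleton]
  -- The growth from `M ∪ {q}` reaches the complement of `s`, and `s` itself comes last.
  · have h1 := (hgr.enumerable hrealiser hextremal).insert hgr.subset (v := s) (fun h => h rfl)
      (by
        rw [Set.insert_eq, Set.union_compl_self]
        exact isIntervalAndTwoIntervals_univ hrealiser hextremal (hne false))
    rw [Set.insert_eq s, Set.union_compl_self] at h1
    exact h1.exists_equiv
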